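/- **Setting.** $G=(V,E)$ is a finite simple undirected graph with maximum degree $\Delta$, $k\ge 2$ is an integer, and $v\in V$. A $k$-graphlet is a connected subgraph induced by $k$ vertices; it is given by its vertex set. $N_v$ is the number of $k$-graphlets of $G$ that contain $v$. For $\mathit{In}\subseteq V$, $N(\mathit{In})$ is the set of vertices outside $\mathit{In}$ with a neighbour in $\mathit{In}$. A vertex $u\notin \mathit{In}$ is *mandatory* for $(G,\mathit{In},k)$ if the connected component of $G-u$ that contains $\mathit{In}$ has at most $k-1$ vertices. **ENUM-V**$(G,\mathit{In},k)$: If $|\mathit{In}|=k-1$, output $\mathit{In}\cup\{u\}$ for every $u\in N(\mathit{In})$ and return. While $|N(\mathit{In})|=1$, move the only vertex of $N(\mathit{In})$ into $\mathit{In}$, and if now $|\mathit{In}|=k-1$, output $\mathit{In}\cup\{u\}$ for every $u\in N(\mathit{In})$ and return. Let $x\ne y$ be two vertices of $N(\mathit{In})$ (return if there are none). If one of them is non-mandatory, let $z$ be such a vertex and call ENUM-V$(G,\mathit{In}\cup\{z\},k)$ and ENUM-V$(G-z,\mathit{In},k)$. Otherwise call LIN-ENUM-V$(G,\mathit{In},k)$.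 **LIN-ENUM-V**$(G,\mathit{In},k)$: If $|\mathit{In}|=k$, output $\mathit{In}$ and return. While $N(\mathit{In})$ has a mandatory vertex, move it into $\mathit{In}$, and if now $|\mathit{In}|=k$, output $\mathit{In}$ and return. Let $w\in N(\mathit{In})$ (return if there is none); call LIN-ENUM-V$(G,\mathit{In}\cup\{w\},k)$ and LIN-ENUM-V$(G-w,\mathit{In},k)$. **Cost model.** The graph is given by doubly linked adjacency lists, in any order, and is modified in place, changes being undone on return. Unit costs are charged for: a test, an arithmetic operation, an access to a constant number of memory cells (including testing membership in, or inserting into, a set of vertices kept as a list with marks), fetching the next neighbour of a vertex, deleting or reinserting one edge, and writing one vertex of an output set. The marks are allocated in advance together with the graph. Whether a single vertex is mandatory is decided by a breadth-first search from $\mathit{In}$ avoiding that vertex and stopped once $k$ vertices have been seen; in LIN-ENUM-V all mandatory vertices are found by one depth-first (lowpoint) search of the component of $\mathit{In}$. **Theorem.** In this model: 1. ENUM-V$(G,\{v\},k)$ outputs every $k$-graphlet of $G$ that contains $v$ exactly once, and nothing else. 2. There is an absolute constant $C$ such that for all $G$, all $k\ge2$, all adjacency-list representations of $G$, and all $v$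 with $N_v\ge 1$ (which holds, for instance, for every $v$ if $G$ is connected and has at least $k$ vertices), the running time of ENUM-V$(G,\{v\},k)$ is at most $C\cdot N_v\cdot k\cdot\min\{k,\Delta\}$. 3. Consequently, for every $D$ there is a constant $C_D$ such that whenever moreover $\Delta\le D$, the running time is at most $C_D\cdot k\cdot N_v$, that is, $O(k)$ amortized time per graphlet. -/

import Mathlib

namespace Graphlet

/-! ### Cost model

A computation returns a value, writes vertex sets (given as lists of vertices) on an output tape,
and takes a number of time units.  Time is spent only through `op` (one elementary operation),
`charge` (a given number of elementary operations) and `emit` (writing one solution, vertex by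
vertex); sequencing computations adds up their times. -/

/-- The outcome of a computation over a vertex type `V`. -/
structure Run (V α : Type) where
  val : α
  out : List (List V)
  time : ℕ

/-- Run `m`, then `f` on its result: outputs are concatenated, times are added. -/
def Run.andThen {V α β : Type} (m : Run V α) (f : α → Run V β) : Run V β :=
  ⟨(f m.val).val, m.out ++ (f m.val).out, m.time + (f m.val).time⟩

instance (V : Type) : Monad (Run V) where
  pure a := ⟨a, [], 0⟩
  bind := Run.andThen

/-- One elementary operation with result `a`: a test, fetching an item of a list, an arithmetic
operation or comparison on numbers, reading or writing a constant number of memory cells, or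
deleting one edge. -/
def op {V α : Type} (a : α) : Run V α := ⟨a, [], 1⟩

/-- Spend `c` elementary operations on initialising or clearing marks or on undoing changes. -/
def charge {V : Type} (c : ℕ) : Run V Unit := ⟨(), [], c⟩

/-- Write the vertex set listed by `S` on the output tape, vertex by vertex. -/
def emit {V : Type} (S : List V) : Run V Unit := ⟨(), [S], S.length⟩

/-! ### Data structures

A graph is stored as doubly linked adjacency lists `A : V → List V` in which the two entries of an
edge point to each other, so that one edge is deleted (or reinserted) by one elementary operation.

A set of vertices (the set `In`, the vertices seen by a search) is stored as a list together with
its size and an array of marks indexed by the vertices.  Hence testing membership, inserting a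
vertex, removing the last inserted vertex and reading the size are elementary operations, while
initialising or clearing a set takes one operation per element.  In the code such a set is just the
list of its elements.  The arrays are allocated beforehand, together with the graph.  Whatever a
call changes is undone before it returns (`charge`), so that a single copy of the graph and of `In`
is kept. -/

/-- `A` is an adjacency list representation of `G`; the lists may come in any order. -/
def IsAdjList {V : Type} (G : SimpleGraph V) (A : V → List V) : Prop :=
  ∀ v, (A v).Nodup ∧ ∀ w, w ∈ A v ↔ G.Adj v w

section

variable {V : Type} [DecidableEq V]

/-- Delete the edge between `z` and `w` from the adjacency lists. -/
def eraseEdge (z : V) (A : V → List V) (w : V) : V → List V :=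
  Function.update (Function.update A w ((A w).erase z)) z ((A z).erase w)

/-- `G - z`: delete the incident edges of `z` one by one.  (The index `z` stays as an isolated
vertex; nothing that happens later can reach it.) -/
def deleteVertex (A : V → List V) (z : V) : Run V (V → List V) :=
  (A z).foldlM (fun B w => op (eraseEdge z B w)) A

/-! ### Scanning the open neighbourhood `N(In)` -/

/-- Scan a list of vertices for vertices outside `In`, stopping as soon as two distinct ones are
known; the last argument holds the (at most two) vertices found so far. -/
def scanTwo (In : List V) : List V → List V → Run V (List V)
  | [], f => pure f
  | w :: ws, f => do
    if ← op (decide (f.length = 2)) then pure f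
    else if ← op (decide (w ∈ In ∨ w ∈ f)) then scanTwo In ws f
    else scanTwo In ws (w :: f)

/-- Find two distinct elements of `N(In)`, or the only one, or none: scan the adjacency lists of
the vertices of `In` (second list argument), stopping as soon as two elements are known. -/
def findTwo (A : V → List V) (In : List V) : List V → List V → Run V (List V)
  | [], f => pure f
  | v :: vs, f => do
    if ← op (decide (f.length = 2)) then pure f
    else
      let f' ← scanTwo In (A v) f
      findTwo A In vs f'

/-- Output `In ∪ {w}`, once for every `w ∈ N(In)`; `seen` collects the `w` met so far. -/
def outputAll (A : V → List V) (In : List V) : Run V Unit := do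
  let seen ← In.foldlM (fun seen v => do
    let nbrs ← op (A v)
    nbrs.foldlM (fun seen w => do
      if ← op (decide (w ∈ In ∨ w ∈ seen)) then pure seen
      else
        emit (w :: In)
        op (w :: seen)) seen) []
  charge seen.length

/-! ### Is a given vertex mandatory? -/

/-- State of a breadth-first search: the vertices seen, and those still to be expanded. -/
structure Bfs (V : Type) where
  seen : List V
  queue : List V

/-- Scan an adjacency list, ignoring `v`, and stop as soon as `k` vertices have been seen. -/
def bfsScan (k : ℕ) (v : V) : List V → Bfs V → Run V (Bfs V)
  | [], s => pure s
  | w :: ws, s => do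
    if ← op (decide (k ≤ s.seen.length)) then pure s
    else if ← op (decide (w = v ∨ w ∈ s.seen)) then bfsScan k v ws s
    else
      let s' ← op (⟨w :: s.seen, s.queue ++ [w]⟩ : Bfs V)
      bfsScan k v ws s'

/-- Expand vertices from the front of the queue, at most as many as the first number says, until
`k` vertices have been seen or the queue is empty. -/
def bfsLoop (A : V → List V) (k : ℕ) (v : V) : ℕ → Bfs V → Run V (Bfs V)
  | 0, s => pure s
  | t + 1, s => do
    if ← op (decide (k ≤ s.seen.length)) then pure s
    else match s.queue with
      | [] => pure s
      | w :: q => do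
        let s' ← bfsScan k v (A w) ⟨s.seen, q⟩
        bfsLoop A k v t s'

/-- `v ∉ In` is mandatory for `A`, `In`, `k`: the component of the graph without `v` that contains
`In` has at most `k - 1` vertices.  Decided by a breadth-first search from `In` that avoids `v` and
stops as soon as `k` vertices have been seen. -/
def isMandatory (A : V → List V) (In : List V) (k : ℕ) (v : V) : Run V Bool := do
  charge In.length
  let s ← bfsLoop A k v k ⟨In, In⟩
  charge s.seen.length
  op (decide (s.seen.length < k))

/-! ### All mandatory vertices at once

A depth-first search from `In`, with `In` regarded as one contracted root, computes lowpoints and,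
for every vertex `v` met outside `In`, the number `cut v` of vertices that `v` separates from
`In`. -/

/-- State of the depth-first search: the vertices seen, their discovery numbers, and the numbers
of vertices that they separate from `In`. -/
structure Dfs (V : Type) where
  seen : List V
  disc : V → ℕ
  cut : V → ℕ

/-- Values kept while the adjacency list of a vertex is scanned: the search state, and for the
current vertex its lowpoint, the size of its search tree, and the number of vertices it cuts off. -/
structure DfsAcc (V : Type) where
  state : Dfs V
  low : ℕ
  size : ℕ
  cut : ℕ

/-- Depth-first search from `v` (recursion depth bounded by the first argument).  A child subtree
is cut off by `v` if its lowpoint is at least the discovery number of `v`. -/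
def dfs (A : V → List V) : ℕ → V → Dfs V → Run V (DfsAcc V)
  | 0, _, s => pure ⟨s, 0, 0, 0⟩
  | t + 1, v, s => do
    let d ← op s.seen.length
    let s₁ ← op (⟨v :: s.seen, Function.update s.disc v d, s.cut⟩ : Dfs V)
    let a ← (A v).foldlM (fun (a : DfsAcc V) w => do
      if ← op (decide (w ∈ a.state.seen)) then
        op ⟨a.state, min a.low (a.state.disc w), a.size, a.cut⟩
      else
        let b ← dfs A t w a.state
        op ⟨b.state, min a.low b.low, a.size + b.size,
          if d ≤ b.low then a.cut + b.size else a.cut⟩) ⟨s₁, d, 1, 0⟩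
    op ⟨⟨a.state.seen, a.state.disc, Function.update a.state.cut v a.cut⟩, a.low, a.size, a.cut⟩

/-- Search the whole component of `In`; `n` bounds the recursion depth.  The vertices of `In` get
discovery number `0`, the others get numbers from `|In|` on. -/
def dfsAll (A : V → List V) (n : ℕ) (In : List V) : Run V (Dfs V) := do
  charge In.length
  let s ← In.foldlM (fun (s : Dfs V) v => do
    let nbrs ← op (A v)
    nbrs.foldlM (fun (s : Dfs V) w => do
      if ← op (decide (w ∈ s.seen)) then pure s
      else
        let a ← dfs A n w s
        op a.state) s) ⟨In, fun _ => 0, fun _ => 0⟩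
  charge s.seen.length
  pure s

/-! ### LIN-ENUM-V -/

/-- State of the loop that moves mandatory vertices into `In`: the set `In`, those of its elements
whose adjacency lists are still to be scanned, and an element of `N(In)` that is not mandatory, if
one has been met. -/
structure Absorb (V : Type) where
  In : List V
  todo : List V
  cand : Option V

/-- Scan an adjacency list and move the mandatory vertices on it into `In`, stopping when `In` has
`k` elements.  With `c` the number of vertices of the component of `In`, a vertex `w ∉ In` of that
component is mandatory if `c - 1 - cut w ≤ k - 1`. -/
def absorbScan (k c : ℕ) (cut : V → ℕ) : List V → Absorb V → Run V (Absorb V)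
  | [], s => pure s
  | w :: ws, s => do
    if ← op (decide (s.In.length = k)) then pure s
    else if ← op (decide (w ∈ s.In)) then absorbScan k c cut ws s
    else if ← op (decide (c ≤ k + cut w)) then
      let s' ← op (⟨w :: s.In, w :: s.todo, s.cand⟩ : Absorb V)
      absorbScan k c cut ws s'
    else
      let s' ← op (⟨s.In, s.todo, some w⟩ : Absorb V)
      absorbScan k c cut ws s'

/-- The loop `while N(In) has a mandatory vertex u: In ← In ∪ {u}`, stopped when `|In| = k`. -/
def absorbLoop (A : V → List V) (k c : ℕ) (cut : V → ℕ) : ℕ → Absorb V → Run V (Absorb V)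
  | 0, s => pure s
  | t + 1, s => do
    if ← op (decide (s.In.length = k)) then pure s
    else match s.todo with
      | [] => pure s
      | v :: q => do
        let s' ← absorbScan k c cut (A v) ⟨s.In, q, s.cand⟩
        absorbLoop A k c cut t s'

/-- LIN-ENUM-V(`A`, `In`, `k`).  Here and below the first number in the recursion bounds its depth,
and `n` is the number of vertices.  The `charge` for removing the added vertices from `In` again on
return is booked as soon as they are known. -/
def linEnumV (n k : ℕ) : ℕ → (V → List V) → List V → Run V Unit
  | 0, _, _ => pure ()
  | t + 1, A, In => do
    if ← op (decide (In.length = k)) then emit In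
    else
      let s ← dfsAll A n In
      charge In.length
      let r ← absorbLoop A k s.seen.length s.cut n ⟨In, In, none⟩
      charge (r.In.length - In.length)
      if ← op (decide (r.In.length = k)) then emit r.In
      else match r.cand with
        | none => pure ()
        | some v => do
          linEnumV n k t A (v :: r.In)
          let A' ← deleteVertex A v
          linEnumV n k t A' r.In
          charge ((A v).length + 1)

/-! ### ENUM-V -/

/-- The loop `while |N(In)| = 1`, where `f` lists up to two elements of `N(In)`: move the only
vertex `v` of `N(In)` into `In` and stop if `|In| = k - 1`; otherwise look for two elements of the
new `N(In)`, all of which are neighbours of `v`. -/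
def chain (A : V → List V) (k : ℕ) : ℕ → List V → List V → Run V (List V × List V)
  | 0, In, f => pure (In, f)
  | t + 1, In, f => do
    if ← op (decide (f.length = 1)) then
      match f with
      | v :: _ => do
        let In' ← op (v :: In)
        if ← op (decide (In'.length = k - 1)) then pure (In', [])
        else
          let f' ← scanTwo In' (A v) []
          chain A k t In' f'
      | [] => pure (In, f)
    else pure (In, f)

/-- A non-mandatory vertex among `x` and `y`, if there is one. -/
def pickNonMandatory (A : V → List V) (In : List V) (k : ℕ) (x y : V) : Run V (Option V) := do
  if ← isMandatory A In k x then
    if ← isMandatory A In k y then pure none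
    else pure (some y)
  else pure (some x)

/-- ENUM-V(`A`, `In`, `k`). -/
def enumV (n k : ℕ) : ℕ → (V → List V) → List V → Run V Unit
  | 0, _, _ => pure ()
  | t + 1, A, In => do
    if ← op (decide (In.length = k - 1)) then outputAll A In
    else
      let f ← findTwo A In In []
      let r ← chain A k k In f
      charge (r.1.length - In.length)
      if ← op (decide (r.1.length = k - 1)) then outputAll A r.1
      else match r.2 with
        | x :: y :: _ => do
          let c ← pickNonMandatory A r.1 k x y
          match c with
          | some z => do
            enumV n k t A (z :: r.1)
            let A' ← deleteVertex A z
            enumV n k t A' r.1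
            charge ((A z).length + 1)
          | none => linEnumV n k n A r.1
        | _ => pure ()

end

/-- The run of ENUM-V on the graph with adjacency lists `A`, with `In = {v}`. -/
def enumFrom {V : Type} [Fintype V] [DecidableEq V] (A : V → List V) (k : ℕ) (v : V) :
    Run V Unit :=
  enumV (Fintype.card V) k (Fintype.card V) A [v]

/-! ### Graphlets -/

/-- The `k`-graphlets of `G` that contain `v`, given by their vertex sets: the sets of `k`
vertices that contain `v` and induce a connected subgraph. -/
def graphletsAt {V : Type} (G : SimpleGraph V) (k : ℕ) (v : V) : Set (Finset V) :=
  {S | S.card = k ∧ v ∈ S ∧ (G.induce (S : Set V)).Connected}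

end Graphlet

/-!
The two procedures are binary branchings.  A solution is a connected set of `k` vertices that
contains `In` (`Solution`).  Branching on `z ∈ N(In)` splits the solutions into those that contain
`z`, which are the solutions for `In ∪ {z}`, and those that avoid `z`, which are the solutions in
`G - z` (`Enumerates.branch`); and a vertex that is moved into `In` without branching, because it is
the only vertex of `N(In)` or because it is mandatory, lies in every solution
(`Solution.exists_bdry`, `Mandatory.mem`).  Hence every solution is output exactly once.

For the time bound put `m = min k Δ`.  As long as the component of `In` has at least `k` vertices
there is a solution (`exists_solution`), and branching only on non-mandatory vertices keeps it so in
both branches.  So every leaf of the recursion tree outputs something, there are fewer inner nodes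
than leaves, and it suffices to spend `O(k m)` per node.

* In ENUM-V this holds for the search for `x` and `y`, the chain and the two breadth-first searches,
  since at most `k` adjacency lists are scanned and all entries scanned, except boundedly many per
  list, lie in a set of at most `k` vertices.  Deleting `z` costs `deg z`, which may exceed `k m`,
  but then it is at most `k` plus the number of solutions that contain `In ∪ {z}`
  (`card_neighbors_le`).  A solution pays for this at most `k` times, since `In` grows each time;
  this gives the summand `2 (k - |In|)` in `enumV_spec`.
* LIN-ENUM-V is called only if `N(In)` has two mandatory vertices, and then the component of `In`
  has at most `2k` vertices (`component_card_le_of_mandatory`), so that all adjacency lists in it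
  have length at most `2m` and searching the whole component costs `O(k m)` (`linEnumV_spec`).

What remains is the correctness of the lowpoint search (`dfsAll_spec`).  Every finished vertex `u`
carries a certificate `CutCert`: a set `K` of `cut u` vertices that can be left only through `u`,
whereas all other vertices seen are reachable from `In` without `u`.  The set `K` is the union of
the child subtrees whose lowpoint is at least the discovery number of `u` (`DfsScan.child`), and the
certificate stays valid when further vertices are found (`CutCert.cons`).
-/

namespace Graphlet

/-! ### Connected sets, reachability and boundaries -/

section Graphs

variable {V : Type}

/-- The set `s` is connected in `G` (or empty), as an induction principle: a property that holds
somewhere in `s` and propagates along the edges inside `s` holds everywhere in `s`. -/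
def Linked (G : SimpleGraph V) (s : Set V) : Prop :=
  ∀ p : V → Prop, (∃ a ∈ s, p a) → (∀ a ∈ s, ∀ b ∈ s, p a → G.Adj a b → p b) → ∀ a ∈ s, p a

/-- `Reach G In w`: the vertex `w` lies in the component of `In`. -/
inductive Reach (G : SimpleGraph V) (In : List V) : V → Prop
  | base {w : V} : w ∈ In → Reach G In w
  | step {u w : V} : Reach G In u → G.Adj u w → Reach G In w

/-- `Bdry G In w`: the vertex `w` lies in the open neighbourhood `N(In)`. -/
def Bdry (G : SimpleGraph V) (In : List V) (w : V) : Prop :=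
  w ∉ In ∧ ∃ a ∈ In, G.Adj a w

/-- The connected sets of `k` vertices that contain `In`. -/
def Solution (G : SimpleGraph V) (k : ℕ) (In : List V) (S : Finset V) : Prop :=
  S.card = k ∧ (∀ x ∈ In, x ∈ S) ∧ Linked G (S : Set V)

theorem linked_iff_preconnected {G : SimpleGraph V} {s : Set V} :
    Linked G s ↔ (G.induce s).Preconnected := by
  constructor
  · rintro h ⟨a, ha⟩ ⟨b, hb⟩
    obtain ⟨hb', h'⟩ := h (fun b => ∃ hb : b ∈ s, (G.induce s).Reachable ⟨a, ha⟩ ⟨b, hb⟩)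
      ⟨a, ha, ha, .refl _⟩
      (fun c hc d hd ⟨_, h1⟩ h2 => ⟨hd, h1.trans (SimpleGraph.Adj.reachable (by simpa using h2))⟩)
      b hb
    exact h'
  · rintro h p ⟨a, ha, hpa⟩ hp b hb
    obtain ⟨w⟩ := h ⟨a, ha⟩ ⟨b, hb⟩
    have key : ∀ x y : s, (G.induce s).Walk x y → p x → p y := by
      intro x y w
      induction w with
      | nil => exact id
      | cons e _ ih => exact fun hx => ih (hp _ (Subtype.prop _) _ (Subtype.prop _) hx (by simpa using e))
    exact key _ _ w hpa

theorem mem_graphletsAt {G : SimpleGraph V} {k : ℕ} {v : V} {S : Finset V} :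
    S ∈ graphletsAt G k v ↔ Solution G k [v] S := by
  simp only [graphletsAt, Set.mem_ofPred_eq, Solution, List.mem_singleton, forall_eq,
    linked_iff_preconnected, SimpleGraph.connected_iff]
  refine and_congr_right fun _ => and_congr_right fun hv => and_iff_left ⟨⟨v, hv⟩⟩

theorem linked_singleton (G : SimpleGraph V) (v : V) : Linked G {v} := by
  rintro p ⟨a, rfl, ha⟩ _ b rfl
  exact ha

theorem Linked.union {G : SimpleGraph V} {s t : Set V} (hs : Linked G s) (ht : Linked G t)
    {a b : V} (ha : a ∈ s) (hb : b ∈ t) (hab : G.Adj a b) : Linked G (s ∪ t) := by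
  rintro p ⟨c, hc, hpc⟩ hp
  have hs' : (∃ c ∈ s, p c) → ∀ c ∈ s, p c := fun h =>
    hs p h fun x hx y hy => hp x (.inl hx) y (.inl hy)
  have ht' : (∃ c ∈ t, p c) → ∀ c ∈ t, p c := fun h =>
    ht p h fun x hx y hy => hp x (.inr hx) y (.inr hy)
  have hall : p a ∧ p b := by
    rcases hc with hc | hc
    · have := hs' ⟨c, hc, hpc⟩ a ha
      exact ⟨this, hp a (.inl ha) b (.inr hb) this hab⟩
    · have := ht' ⟨c, hc, hpc⟩ b hb
      exact ⟨hp b (.inr hb) a (.inl ha) this hab.symm, this⟩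
  rintro x (hx | hx)
  · exact hs' ⟨a, ha, hall.1⟩ x hx
  · exact ht' ⟨b, hb, hall.2⟩ x hx

theorem Linked.cons {G : SimpleGraph V} {In : List V} (h : Linked G {x | x ∈ In}) {w : V}
    (hw : ∃ a ∈ In, G.Adj a w) : Linked G {x | x ∈ w :: In} := by
  obtain ⟨a, ha, haw⟩ := hw
  have := h.union (linked_singleton G w) ha rfl haw
  convert this using 1
  ext x
  simp

theorem Linked.mono {G H : SimpleGraph V} {s : Set V} (h : Linked G s)
    (hGH : ∀ a ∈ s, ∀ b ∈ s, G.Adj a b → H.Adj a b) : Linked H s :=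
  fun p h1 h2 => h p h1 fun a ha b hb hp hab => h2 a ha b hb hp (hGH a ha b hb hab)

theorem linked_deleteIncidenceSet {G : SimpleGraph V} {s : Set V} {z : V} (hz : z ∉ s) :
    Linked (G.deleteIncidenceSet z) s ↔ Linked G s := by
  refine ⟨fun h => h.mono fun a _ b _ => fun hab => (SimpleGraph.deleteIncidenceSet_adj.1 hab).1,
    fun h => h.mono fun a ha b hb hab => SimpleGraph.deleteIncidenceSet_adj.2 ⟨hab, ?_, ?_⟩⟩
  · rintro rfl; exact hz ha
  · rintro rfl; exact hz hb

/-! ### Reachability and solutions -/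

theorem Reach.closed {G : SimpleGraph V} {In : List V} {p : V → Prop}
    (h0 : ∀ x ∈ In, p x) (h1 : ∀ a b, p a → G.Adj a b → p b) {w : V} (h : Reach G In w) : p w := by
  induction h with
  | base h => exact h0 _ h
  | step _ e ih => exact h1 _ _ ih e

theorem Reach.of_reach {G H : SimpleGraph V} {In In' : List V} (hI : ∀ x ∈ In, Reach H In' x)
    (hGH : G ≤ H) {w : V} (h : Reach G In w) : Reach H In' w :=
  h.closed hI fun _ _ ha hab => ha.step (hGH hab)

theorem Reach.delete_le {G : SimpleGraph V} {In : List V} {z w : V}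
    (h : Reach (G.deleteIncidenceSet z) In w) : Reach G In w :=
  h.of_reach (fun _ => .base) (SimpleGraph.deleteIncidenceSet_le G z)

theorem Reach.delete_ne {G : SimpleGraph V} {In : List V} {z w : V} (hz : z ∉ In)
    (h : Reach (G.deleteIncidenceSet z) In w) : w ≠ z := by
  refine h.closed (p := fun w => w ≠ z) (fun x hx => ?_) fun a b _ hab => ?_
  · rintro rfl; exact hz hx
  · exact (SimpleGraph.deleteIncidenceSet_adj.1 hab).2.2

theorem Reach.step_delete {G : SimpleGraph V} {In : List V} {z a b : V} (hz : z ∉ In)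
    (h : Reach (G.deleteIncidenceSet z) In a) (hab : G.Adj a b) (hb : b ≠ z) :
    Reach (G.deleteIncidenceSet z) In b :=
  h.step (SimpleGraph.deleteIncidenceSet_adj.2 ⟨hab, h.delete_ne hz, hb⟩)

theorem Bdry.reach {G : SimpleGraph V} {In : List V} {w : V} (h : Bdry G In w) : Reach G In w := by
  obtain ⟨_, a, ha, haw⟩ := h
  exact (Reach.base ha).step haw

theorem Bdry.reach_delete {G : SimpleGraph V} {In : List V} {z w : V} (hz : z ∉ In)
    (h : Bdry G In w) (hw : w ≠ z) : Reach (G.deleteIncidenceSet z) In w := by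
  obtain ⟨_, a, ha, haw⟩ := h
  exact (Reach.base ha).step_delete hz haw hw

/-- Everything reachable from a connected set is reachable from any of its elements. -/
theorem Linked.reach_of_subset {G : SimpleGraph V} {In In' : List V} (hl : Linked G {x | x ∈ In'})
    (h0 : ∃ x ∈ In', x ∈ In) : ∀ x ∈ In', Reach G In x := by
  obtain ⟨x, hx, hx'⟩ := h0
  exact hl (Reach G In) ⟨x, hx, .base hx'⟩ fun a _ b _ ha hab => ha.step hab

/-- Growing a connected set inside its component does not change the component. -/
theorem reach_iff_of_subset {G : SimpleGraph V} {In In' : List V} (hl : Linked G {x | x ∈ In'})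
    (hne : In ≠ []) (hs : ∀ x ∈ In, x ∈ In') {w : V} : Reach G In' w ↔ Reach G In w := by
  obtain ⟨x, hx⟩ := List.exists_mem_of_ne_nil _ hne
  exact ⟨fun h => h.of_reach (hl.reach_of_subset ⟨x, hs x hx, hx⟩) le_rfl,
    fun h => h.of_reach (fun y hy => .base (hs y hy)) le_rfl⟩

theorem Solution.reach {G : SimpleGraph V} {k : ℕ} {In : List V} {S : Finset V}
    (h : Solution G k In S) (hne : In ≠ []) : ∀ x ∈ S, Reach G In x := by
  obtain ⟨x, hx⟩ := List.exists_mem_of_ne_nil _ hne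
  exact h.2.2 (Reach G In) ⟨x, h.2.1 x hx, .base hx⟩ fun a _ b _ ha hab => ha.step hab

/-- A solution larger than `In` contains a vertex of `N(In)`. -/
theorem Solution.exists_bdry {G : SimpleGraph V} {k : ℕ} {In : List V} {S : Finset V}
    (h : Solution G k In S) (hne : In ≠ []) (hk : In.length < k) : ∃ w ∈ S, Bdry G In w := by
  classical
  by_contra! hno
  obtain ⟨x, hx⟩ := List.exists_mem_of_ne_nil _ hne
  have hall : ∀ a ∈ (S : Set V), a ∈ In := h.2.2 (· ∈ In) ⟨x, h.2.1 x hx, hx⟩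
    fun a _ b hb ha hab => by
      by_contra hb'
      exact hno b hb ⟨hb', a, ha, hab⟩
  have h1 : S ⊆ In.toFinset := fun a ha => List.mem_toFinset.2 (hall a ha)
  have := Finset.card_le_card h1
  have := In.toFinset_card_le
  have := h.1
  omega

theorem solution_cons {G : SimpleGraph V} {k : ℕ} {In : List V} {z : V} {S : Finset V} :
    Solution G k (z :: In) S ↔ Solution G k In S ∧ z ∈ S := by
  simp only [Solution, List.forall_mem_cons]
  tauto

/-- The solutions that avoid a vertex `z` outside `In` are those of the graph without `z`. -/
theorem solution_deleteIncidenceSet {G : SimpleGraph V} {k : ℕ} {In : List V} {z : V}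
    {S : Finset V} (hne : In ≠ []) (hz : z ∉ In) :
    Solution (G.deleteIncidenceSet z) k In S ↔ Solution G k In S ∧ z ∉ S := by
  constructor
  · intro h
    have hzS : z ∉ S := fun hzS => (h.reach hne z hzS).delete_ne hz rfl
    exact ⟨⟨h.1, h.2.1, (linked_deleteIncidenceSet (by simpa using hzS)).1 h.2.2⟩, hzS⟩
  · rintro ⟨h, hzS⟩
    exact ⟨h.1, h.2.1, (linked_deleteIncidenceSet (by simpa using hzS)).2 h.2.2⟩

/-- A vertex `z` of large degree in `In` forces many solutions: fix all but one of the neighbours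
that are to be added to `In` and vary the last one. -/
theorem card_neighbors_le {G : SimpleGraph V} {k : ℕ} {In : List V}
    (hn : In.Nodup) (hl : Linked G {x | x ∈ In}) (hk : In.length < k) {z : V}
    (hz : z ∈ In) (N : Finset V) (hN : ∀ w ∈ N, G.Adj z w) (F : Finset (Finset V))
    (hF : ∀ S, Solution G k In S → S ∈ F) : N.card ≤ k + F.card := by
  classical
  set M := N \ In.toFinset with hM
  have hMc : N.card ≤ M.card + In.length := by
    have h1 : N.card - In.toFinset.card ≤ M.card := Finset.le_card_sdiff In.toFinset N
    have h2 := In.toFinset_card_le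
    omega
  by_cases hsmall : M.card < k - 1 - In.length
  · omega
  · obtain ⟨B, hBM, hBc⟩ := Finset.exists_subset_card_eq (not_lt.1 hsmall)
    have hadd : ∀ T : Finset V, T ⊆ M → Linked G (↑(In.toFinset ∪ T) : Set V) := by
      intro T
      induction T using Finset.induction_on with
      | empty => intro _; simpa using hl
      | insert u T hu ih =>
        intro hT
        have h1 := ih ((Finset.subset_insert _ _).trans hT)
        have h2 := h1.union (linked_singleton G u) (a := z) (b := u) (by simp [hz]) rfl
          (hN u (Finset.mem_sdiff.1 (hT (Finset.mem_insert_self _ _))).1)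
        convert h2 using 1
        ext x
        simp
    have hmaps : ∀ u ∈ M \ B, In.toFinset ∪ insert u B ∈ F := by
      intro u hu
      rw [Finset.mem_sdiff] at hu
      have hsub : insert u B ⊆ M := Finset.insert_subset hu.1 hBM
      refine hF _ ⟨?_, fun x hx => by simp [hx], hadd _ hsub⟩
      rw [Finset.card_union_of_disjoint, List.toFinset_card_of_nodup hn,
        Finset.card_insert_of_notMem hu.2, hBc]
      · omega
      · exact (Finset.disjoint_sdiff.mono_right hsub)
    have hinj : Set.InjOn (fun u => In.toFinset ∪ insert u B) ↑(M \ B) := by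
      intro u hu u' hu' heq
      rw [Finset.mem_coe, Finset.mem_sdiff] at hu hu'
      have : u ∈ In.toFinset ∪ insert u' B := by
        rw [← show In.toFinset ∪ insert u B = In.toFinset ∪ insert u' B from heq]; simp
      have hu3 := (Finset.mem_sdiff.1 hu.1).2
      simp only [Finset.mem_union, Finset.mem_insert, hu.2, hu3, or_false, false_or] at this
      exact this
    have := Finset.card_le_card_of_injOn _ hmaps hinj
    rw [Finset.card_sdiff_of_subset hBM] at this
    omega

variable [Fintype V]

open Classical in
/-- The vertex set of the component of `In`. -/
noncomputable def component (G : SimpleGraph V) (In : List V) : Finset V :=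
  Finset.univ.filter (Reach G In)

@[simp] theorem mem_component {G : SimpleGraph V} {In : List V} {w : V} :
    w ∈ component G In ↔ Reach G In w := by
  simp [component]

/-- `u` is mandatory: the component of `In` in the graph without `u` has at most `k - 1`
vertices. -/
def Mandatory (G : SimpleGraph V) (In : List V) (k : ℕ) (u : V) : Prop :=
  (component (G.deleteIncidenceSet u) In).card < k

theorem component_eq_of_subset {G : SimpleGraph V} {In In' : List V}
    (hl : Linked G {x | x ∈ In'}) (hne : In ≠ []) (hs : ∀ x ∈ In, x ∈ In') :
    component G In' = component G In := by
  ext w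
  simp [reach_iff_of_subset hl hne hs]

theorem mandatory_iff_of_subset {G : SimpleGraph V} {In In' : List V} {k : ℕ} {u : V}
    (hl : Linked G {x | x ∈ In'}) (hne : In ≠ []) (hs : ∀ x ∈ In, x ∈ In') (hu : u ∉ In') :
    Mandatory G In' k u ↔ Mandatory G In k u := by
  rw [Mandatory, Mandatory,
    component_eq_of_subset ((linked_deleteIncidenceSet (by simpa using hu)).2 hl) hne hs]

theorem component_delete_subset {G : SimpleGraph V} {In : List V} {z : V} :
    component (G.deleteIncidenceSet z) In ⊆ component G In := by
  intro w hw
  rw [mem_component] at *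
  exact hw.delete_le

theorem component_delete_card_lt {G : SimpleGraph V} {In : List V} {z : V} (hz : z ∉ In)
    (hr : Reach G In z) :
    (component (G.deleteIncidenceSet z) In).card < (component G In).card := by
  refine Finset.card_lt_card ⟨component_delete_subset, fun h => ?_⟩
  have := h (mem_component.2 hr)
  exact (mem_component.1 this).delete_ne hz rfl

theorem length_le_component {G : SimpleGraph V} {In : List V} (hn : In.Nodup) :
    In.length ≤ (component G In).card := by
  classical
  rw [← List.toFinset_card_of_nodup hn]
  refine Finset.card_le_card fun x hx => ?_
  rw [mem_component]
  exact .base (List.mem_toFinset.1 hx)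

/-- Every solution contains every mandatory vertex. -/
theorem Mandatory.mem {G : SimpleGraph V} {In : List V} {k : ℕ} {u : V} (h : Mandatory G In k u)
    (hne : In ≠ []) (hu : u ∉ In) {S : Finset V} (hS : Solution G k In S) : u ∈ S := by
  by_contra huS
  have h1 := ((solution_deleteIncidenceSet hne hu).2 ⟨hS, huS⟩).reach hne
  have : S ⊆ component (G.deleteIncidenceSet u) In := fun x hx => mem_component.2 (h1 x hx)
  have := Finset.card_le_card this
  have := hS.1
  unfold Mandatory at h
  omega

/-- If `In` is smaller than its component, then `N(In)` is not empty. -/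
theorem exists_bdry_of_lt {G : SimpleGraph V} {In : List V}
    (hk : In.length < (component G In).card) : ∃ w, Bdry G In w := by
  classical
  by_contra! hno
  have : component G In ⊆ In.toFinset := by
    intro w hw
    rw [mem_component] at hw
    rw [List.mem_toFinset]
    refine hw.closed (p := (· ∈ In)) (fun _ => id) fun a b ha hab => ?_
    by_contra hb
    exact hno b ⟨hb, a, ha, hab⟩
  have := Finset.card_le_card this
  have := In.toFinset_card_le
  omega

/-- A connected set of at most `k` vertices extends to a solution if its component has at least `k`
vertices. -/
theorem exists_solution {G : SimpleGraph V} {k : ℕ} {In : List V} (hn : In.Nodup) (hne : In ≠ [])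
    (hl : Linked G {x | x ∈ In}) (hk : In.length ≤ k) (hc : k ≤ (component G In).card) :
    ∃ S, Solution G k In S := by
  classical
  obtain ⟨d, hd⟩ := Nat.exists_eq_add_of_le hk
  induction d generalizing In with
  | zero =>
    exact ⟨In.toFinset, by rw [List.toFinset_card_of_nodup hn]; omega, fun x => by simp,
      by simpa using hl⟩
  | succ d ih =>
    obtain ⟨w, hw⟩ := exists_bdry_of_lt (G := G) (In := In) (by omega)
    have hl' := hl.cons hw.2
    obtain ⟨S, hS⟩ := ih (In := w :: In) (by simp [hn, hw.1]) (by simp) hl' (by simp; omega)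
      (by rwa [component_eq_of_subset hl' hne (by simp +contextual)]) (by simp; omega)
    exact ⟨S, (solution_cons.1 hS).1⟩

/-- If `N(In)` has two mandatory vertices `x` and `y`, then the component of `In` has at most `2k`
vertices, since each of them is reachable without `x` or without `y`: when a path from `In` that
avoids one of the two meets it after all, restart it there, by the edge from `In`. -/
theorem component_card_le_of_mandatory {G : SimpleGraph V} {In : List V} {k : ℕ} {x y : V}
    (hx : Bdry G In x) (hy : Bdry G In y) (hxy : x ≠ y) (mx : Mandatory G In k x)
    (my : Mandatory G In k y) : (component G In).card ≤ 2 * k := by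
  classical
  have key : component G In ⊆ component (G.deleteIncidenceSet x) In ∪
      component (G.deleteIncidenceSet y) In := by
    intro w hw
    simp only [mem_component, Finset.mem_union] at *
    refine hw.closed (p := fun w => Reach (G.deleteIncidenceSet x) In w ∨
      Reach (G.deleteIncidenceSet y) In w) (fun w hw => .inl (.base hw)) ?_
    rintro a b (ha | ha) hab
    · rcases eq_or_ne b x with rfl | hb
      · exact .inr (hx.reach_delete hy.1 hxy)
      · exact .inl (ha.step_delete hx.1 hab hb)
    · rcases eq_or_ne b y with rfl | hb
      · exact .inl (hy.reach_delete hx.1 hxy.symm)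
      · exact .inr (ha.step_delete hy.1 hab hb)
  have h1 := Finset.card_le_card key
  have h2 := Finset.card_union_le (component (G.deleteIncidenceSet x) In)
    (component (G.deleteIncidenceSet y) In)
  unfold Mandatory at mx my
  omega

end Graphs

/-! ### Reasoning about runs -/

section RunLogic

variable {V α β : Type}

@[simp] theorem Run.val_pure (a : α) : (pure a : Run V α).val = a := rfl
@[simp] theorem Run.out_pure (a : α) : (pure a : Run V α).out = [] := rfl
@[simp] theorem Run.time_pure (a : α) : (pure a : Run V α).time = 0 := rfl
@[simp] theorem Run.val_bind (m : Run V α) (f : α → Run V β) :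
    (m >>= f).val = (f m.val).val := rfl
@[simp] theorem Run.out_bind (m : Run V α) (f : α → Run V β) :
    (m >>= f).out = m.out ++ (f m.val).out := rfl
@[simp] theorem Run.time_bind (m : Run V α) (f : α → Run V β) :
    (m >>= f).time = m.time + (f m.val).time := rfl
@[simp] theorem Run.val_op (a : α) : (op a : Run V α).val = a := rfl
@[simp] theorem Run.out_op (a : α) : (op a : Run V α).out = [] := rfl
@[simp] theorem Run.time_op (a : α) : (op a : Run V α).time = 1 := rfl
@[simp] theorem Run.out_charge (c : ℕ) : (charge c : Run V Unit).out = [] := rfl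
@[simp] theorem Run.time_charge (c : ℕ) : (charge c : Run V Unit).time = c := rfl
@[simp] theorem Run.out_emit (S : List V) : (emit S : Run V Unit).out = [S] := rfl
@[simp] theorem Run.time_emit (S : List V) : (emit S : Run V Unit).time = S.length := rfl

/-- The computation `m` writes nothing, and its value and its time satisfy `Q`. -/
def Run.Silent (m : Run V α) (Q : α → ℕ → Prop) : Prop :=
  m.out = [] ∧ Q m.val m.time

theorem Run.Silent.mono {m : Run V α} {Q Q' : α → ℕ → Prop} (h : m.Silent Q)
    (hQ : ∀ a t, Q a t → Q' a t) : m.Silent Q' :=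
  ⟨h.1, hQ _ _ h.2⟩

theorem Run.Silent.bind {m : Run V α} {f : α → Run V β} {Q : α → ℕ → Prop} {R : β → ℕ → Prop}
    (h : m.Silent Q) (hf : ∀ a t, Q a t → (f a).Silent fun b t' => R b (t + t')) :
    (m >>= f).Silent R := by
  obtain ⟨h1, h2⟩ := h
  obtain ⟨h3, h4⟩ := hf _ _ h2
  exact ⟨by simp [h1, h3], h4⟩

theorem Run.silent_pure {a : α} {Q : α → ℕ → Prop} (h : Q a 0) : (pure a : Run V α).Silent Q :=
  ⟨rfl, h⟩

theorem Run.silent_op {a : α} {Q : α → ℕ → Prop} (h : Q a 1) : (op a : Run V α).Silent Q :=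
  ⟨rfl, h⟩

theorem Run.silent_op_bind {a : α} {f : α → Run V β} {R : β → ℕ → Prop}
    (h : (f a).Silent fun b t => R b (1 + t)) : (op a >>= f).Silent R :=
  ⟨h.1, h.2⟩

theorem Run.silent_charge_bind {c : ℕ} {f : Unit → Run V β} {R : β → ℕ → Prop}
    (h : (f ()).Silent fun b t => R b (c + t)) : (charge c >>= f).Silent R :=
  ⟨h.1, h.2⟩

/-- Invariants for a loop over a list; `I` is told which part of the list has been processed. -/
theorem Run.foldlM_induction {f : α → β → Run V α} {l : List β} {a : α}
    (I : List β → α → List (List V) → ℕ → Prop) (h0 : I [] a [] 0)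
    (hs : ∀ pre w suf a o t, l = pre ++ w :: suf → I pre a o t →
      I (pre ++ [w]) (f a w).val (o ++ (f a w).out) (t + (f a w).time)) :
    I l (l.foldlM f a).val (l.foldlM f a).out (l.foldlM f a).time := by
  suffices h : ∀ suf pre a o t, l = pre ++ suf → I pre a o t →
      I l (suf.foldlM f a).val (o ++ (suf.foldlM f a).out) (t + (suf.foldlM f a).time) by
    simpa using h l [] a [] 0 rfl h0
  intro suf
  induction suf with
  | nil =>
    intro pre a o t hl hI
    rw [List.append_nil] at hl
    simpa [hl] using hI
  | cons w suf ih =>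
    intro pre a o t hl hI
    simpa [List.foldlM_cons, Nat.add_assoc] using
      ih (pre ++ [w]) _ _ _ (by simp [hl]) (hs pre w suf a o t hl hI)

theorem Run.silent_foldlM {f : α → β → Run V α} {l : List β} {a : α} (I : List β → α → ℕ → Prop)
    (h0 : I [] a 0)
    (hs : ∀ pre w suf a t, l = pre ++ w :: suf → I pre a t →
      (f a w).Silent fun b t' => I (pre ++ [w]) b (t + t')) :
    (l.foldlM f a).Silent (I l) := by
  refine Run.foldlM_induction (fun pre a o t => o = [] ∧ I pre a t) ⟨rfl, h0⟩ ?_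
  rintro pre w suf a o t hl ⟨rfl, hI⟩
  have := hs pre w suf a t hl hI
  exact ⟨by simp [this.1], this.2⟩

end RunLogic

/-! ### Vertex deletion and the search for two boundary vertices -/

section Subroutines

variable {V : Type}

theorem length_le_of_nodup_subset {L M : List V} (hL : L.Nodup) (h : ∀ x ∈ L, x ∈ M) :
    L.length ≤ M.length :=
  (List.subperm_of_subset hL h).length_le

theorem IsAdjList.length_le {G H : SimpleGraph V} {A B : V → List V} (hA : IsAdjList G A)
    (hB : IsAdjList H B) (hGH : H ≤ G) (v : V) : (B v).length ≤ (A v).length :=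
  length_le_of_nodup_subset (hB v).1 fun w hw =>
    ((hA v).2 w).2 (hGH (((hB v).2 w).1 hw))

/-- A quantity bounded by multiples of two numbers is bounded by a multiple of their minimum. -/
theorem le_mul_min {x c a b : ℕ} (ha : x ≤ c * a) (hb : x ≤ c * b) : x ≤ c * min a b := by
  rcases min_choice a b with h | h <;> rwa [h]

/-- `f` lists two elements of the set `p`, or the whole of `p` if `p` has fewer elements. -/
structure TwoOf (p : V → Prop) (f : List V) : Prop where
  nodup : f.Nodup
  length_le : f.length ≤ 2
  mem : ∀ w ∈ f, p w
  all : f.length < 2 → ∀ w, p w → w ∈ f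

theorem TwoOf.congr {p q : V → Prop} {f : List V} (h : TwoOf p f) (hpq : ∀ w, p w ↔ q w) :
    TwoOf q f :=
  ⟨h.nodup, h.length_le, fun w hw => (hpq w).1 (h.mem w hw),
    fun hf w hw => h.all hf w ((hpq w).2 hw)⟩

/-- The set `In` of a call of the enumeration procedures: a nonempty connected set, listed without
repetition, with at most `k` elements. -/
structure IsRoot (G : SimpleGraph V) (k : ℕ) (In : List V) : Prop where
  nodup : In.Nodup
  ne_nil : In ≠ []
  linked : Linked G {x | x ∈ In}
  length_le : In.length ≤ k

theorem IsRoot.cons {G : SimpleGraph V} {k : ℕ} {In : List V} (h : IsRoot G k In) {w : V}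
    (hw : Bdry G In w) (hk : In.length < k) : IsRoot G k (w :: In) :=
  ⟨by simp [h.nodup, hw.1], by simp, h.linked.cons hw.2, hk⟩

theorem IsRoot.delete {G : SimpleGraph V} {k : ℕ} {In : List V} (h : IsRoot G k In) {w : V}
    (hw : w ∉ In) : IsRoot (G.deleteIncidenceSet w) k In :=
  ⟨h.nodup, h.ne_nil, (linked_deleteIncidenceSet (by simpa using hw)).2 h.linked, h.length_le⟩

variable [DecidableEq V]

theorem length_filter_mem_le {L M : List V} (hL : L.Nodup) :
    (L.filter (· ∈ M)).length ≤ M.length :=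
  length_le_of_nodup_subset (hL.filter _) fun x hx => by simpa using (List.mem_filter.1 hx).2

theorem deleteVertex_spec {G : SimpleGraph V} {A : V → List V} (hA : IsAdjList G A) (z : V) :
    (deleteVertex A z).Silent fun B t =>
      IsAdjList (G.deleteIncidenceSet z) B ∧ t = (A z).length := by
  unfold deleteVertex
  refine (Run.silent_foldlM (fun pre B t => t = pre.length ∧ ∀ v, (B v).Nodup ∧ ∀ w, w ∈ B v ↔
    G.Adj v w ∧ ¬ (v = z ∧ w ∈ pre) ∧ ¬ (w = z ∧ v ∈ pre)) ?_ ?_).mono ?_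
  · simpa using (show ∀ v, _ from hA)
  · rintro pre u suf B t hl ⟨rfl, hB⟩
    refine Run.silent_op ⟨by simp, fun v => ?_⟩
    have hu : G.Adj z u := ((hA z).2 u).1 (by simp [hl])
    have hzu : z ≠ u := hu.ne
    unfold eraseEdge
    rcases eq_or_ne v z with rfl | hvz
    · rw [Function.update_self]
      refine ⟨(hB v).1.erase u, fun w => ?_⟩
      rw [(hB v).1.mem_erase_iff, (hB v).2]
      have := G.irrefl (v := v)
      simp only [List.mem_append, List.mem_singleton]
      constructor
      · rintro ⟨h1, h2, h3, h4⟩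
        exact ⟨h2, by tauto, by rintro ⟨rfl, _⟩; exact this h2⟩
      · rintro ⟨h2, h3, h4⟩
        exact ⟨by tauto, h2, by tauto, by tauto⟩
    · rw [Function.update_of_ne hvz]
      rcases eq_or_ne v u with rfl | hvu
      · rw [Function.update_self]
        refine ⟨(hB v).1.erase z, fun w => ?_⟩
        rw [(hB v).1.mem_erase_iff, (hB v).2]
        simp only [List.mem_append, List.mem_singleton]
        tauto
      · rw [Function.update_of_ne hvu]
        refine ⟨(hB v).1, fun w => ?_⟩
        rw [(hB v).2]
        simp only [List.mem_append, List.mem_singleton]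
        tauto
  · rintro B t ⟨rfl, hB⟩
    refine ⟨fun v => ⟨(hB v).1, fun w => ?_⟩, rfl⟩
    rw [(hB v).2, SimpleGraph.deleteIncidenceSet_adj, (hA z).2, (hA z).2]
    constructor
    · rintro ⟨h1, h2, h3⟩
      refine ⟨h1, ?_, ?_⟩
      · rintro rfl; exact h2 ⟨rfl, h1⟩
      · rintro rfl; exact h3 ⟨rfl, h1.symm⟩
    · tauto

/-- The second time bound counts the scanned entries that are no new elements; it is independent of
the length of `L`, since an element of `L` occurs only once. -/
theorem scanTwo_spec (In : List V) : ∀ (L f : List V) (p : V → Prop), TwoOf p f →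
    (scanTwo In L f).Silent fun f' t => TwoOf (fun w => p w ∨ w ∈ L ∧ w ∉ In) f' ∧
      t ≤ 2 * L.length ∧ (L.Nodup → t ≤ 2 * (L.filter (· ∈ f ++ In)).length +
        2 * (2 - f.length) + 1) := by
  intro L
  induction L with
  | nil =>
    intro f p hf
    exact Run.silent_pure ⟨hf.congr (by simp), by simp, by simp⟩
  | cons w ws ih =>
    intro f p hf
    rw [scanTwo]
    refine Run.silent_op_bind ?_
    by_cases h2 : f.length = 2
    · simp only [h2, decide_true, if_true]
      refine Run.silent_pure ⟨⟨hf.nodup, hf.length_le, fun w hw => .inl (hf.mem w hw),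
        fun h => by omega⟩, by simp; omega, fun _ => by omega⟩
    · have hlt : f.length < 2 := by have := hf.length_le; omega
      simp only [h2, decide_false, Bool.false_eq_true, if_false]
      refine Run.silent_op_bind ?_
      by_cases hw : w ∈ In ∨ w ∈ f
      · simp only [hw, decide_true, if_true]
        refine (ih f p hf).mono ?_
        rintro f' t ⟨h3, h4, h5⟩
        refine ⟨h3.congr fun u => ?_, by simp; omega, fun hn => ?_⟩
        · rw [List.mem_cons]
          constructor
          · tauto
          · rintro (h | ⟨rfl | h, h'⟩)
            · exact .inl h
            · exact .inl (hf.mem _ (by tauto))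
            · exact .inr ⟨h, h'⟩
        · have := h5 hn.of_cons
          rw [List.filter_cons_of_pos (by simp; tauto), List.length_cons]
          omega
      · simp only [hw, decide_false, Bool.false_eq_true, if_false]
        push Not at hw
        have hf' : TwoOf (fun u => p u ∨ u = w) (w :: f) := by
          refine ⟨by simp [hf.nodup, hw.2], by simp; omega, ?_, ?_⟩
          · simp only [List.mem_cons]
            rintro u (rfl | hu)
            · exact .inr rfl
            · exact .inl (hf.mem _ hu)
          · rintro - u (hu | rfl)
            · exact List.mem_cons_of_mem _ (hf.all hlt u hu)
            · exact List.mem_cons_self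
        refine (ih (w :: f) _ hf').mono ?_
        rintro f' t ⟨h3, h4, h5⟩
        refine ⟨h3.congr fun u => ?_, by simp; omega, fun hn => ?_⟩
        · rw [List.mem_cons]
          constructor
          · rintro ((h | rfl) | h)
            · exact .inl h
            · exact .inr ⟨.inl rfl, hw.1⟩
            · tauto
          · tauto
        · have h6 := h5 hn.of_cons
          have h7 : ws.filter (· ∈ w :: f ++ In) = ws.filter (· ∈ f ++ In) := by
            refine List.filter_congr fun u hu => ?_
            have : u ≠ w := by rintro rfl; exact (List.nodup_cons.1 hn).1 hu
            simp [this]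
          rw [h7, List.length_cons] at h6
          rw [List.filter_cons_of_neg (by simp; tauto)]
          omega

theorem scanTwo_time {In L f : List V} {p : V → Prop} {k D : ℕ} (hf : TwoOf p f)
    (hL : L.Nodup) (hIn : In.length ≤ k) (hk : 2 ≤ k) (hD : L.length ≤ D) :
    (scanTwo In L f).Silent fun f' t => TwoOf (fun w => p w ∨ w ∈ L ∧ w ∉ In) f' ∧
      t ≤ 7 * min k D := by
  refine (scanTwo_spec In L f p hf).mono ?_
  rintro f' t ⟨h1, h2, h3⟩
  refine ⟨h1, le_mul_min ?_ (by omega)⟩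
  have h4 := h3 hL
  have h5 := length_filter_mem_le (M := f ++ In) hL
  have h6 := hf.length_le
  rw [List.length_append] at h5
  omega

theorem findTwo_spec {G : SimpleGraph V} {A : V → List V} {In : List V} {k D : ℕ}
    (hA : IsAdjList G A) (hIn : In.length ≤ k) (hk : 2 ≤ k) (hD : ∀ v, (A v).length ≤ D) :
    ∀ (L f : List V) (p : V → Prop), TwoOf p f →
    (findTwo A In L f).Silent fun f' t =>
      TwoOf (fun w => p w ∨ w ∉ In ∧ ∃ a ∈ L, G.Adj a w) f' ∧
      t ≤ L.length * (1 + 7 * min k D) := by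
  intro L
  induction L with
  | nil =>
    intro f p hf
    exact Run.silent_pure ⟨hf.congr (by simp), by simp⟩
  | cons v vs ih =>
    intro f p hf
    rw [findTwo]
    refine Run.silent_op_bind ?_
    by_cases h2 : f.length = 2
    · simp only [h2, decide_true, if_true]
      refine Run.silent_pure ⟨⟨hf.nodup, hf.length_le, fun w hw => .inl (hf.mem w hw),
        fun h => by omega⟩, ?_⟩
      rw [List.length_cons, Nat.succ_mul]
      omega
    · simp only [h2, decide_false, Bool.false_eq_true, if_false]
      refine (scanTwo_time hf (hA v).1 hIn hk (hD v)).bind ?_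
      rintro f' t ⟨hf', ht⟩
      refine (ih f' _ hf').mono ?_
      rintro f'' t' ⟨hf'', ht'⟩
      refine ⟨hf''.congr fun w => ?_, ?_⟩
      · simp only [(hA v).2, List.mem_cons, or_and_right, exists_or, exists_eq_left]
        tauto
      · rw [List.length_cons, Nat.succ_mul]
        omega

/-- The elements of `N(In)` found by `findTwo`. -/
theorem findTwo_bdry {G : SimpleGraph V} {A : V → List V} {In : List V} {k D : ℕ}
    (hA : IsAdjList G A) (hIn : In.length ≤ k) (hk : 2 ≤ k) (hD : ∀ v, (A v).length ≤ D) :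
    (findTwo A In In []).Silent fun f t => TwoOf (Bdry G In) f ∧
      t ≤ k * (1 + 7 * min k D) := by
  refine (findTwo_spec hA hIn hk hD In [] (fun _ => False) ⟨by simp, by simp, by simp, by simp⟩).mono
    ?_
  rintro f t ⟨h1, h2⟩
  exact ⟨h1.congr fun w => by simp [Bdry], h2.trans (Nat.mul_le_mul_right _ hIn)⟩

/-- The chain keeps all solutions, since the only vertex of `N(In)` lies in every solution.  With
the fuel `k` it ends because `In` has `k - 1` elements or `N(In)` does not consist of one vertex. -/
theorem chain_spec {G : SimpleGraph V} {A : V → List V} {k D : ℕ} (hA : IsAdjList G A)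
    (hk : 2 ≤ k) (hD : ∀ v, (A v).length ≤ D) (hD1 : 1 ≤ D) :
    ∀ (t : ℕ) (In f : List V), IsRoot G k In → In.length < k - 1 → k < t + In.length + 1 →
    TwoOf (Bdry G In) f →
    (chain A k t In f).Silent fun r time => IsRoot G k r.1 ∧ (∀ x ∈ In, x ∈ r.1) ∧
      r.1.length ≤ k - 1 ∧ (∀ S, Solution G k In S → Solution G k r.1 S) ∧
      (r.1.length ≠ k - 1 → TwoOf (Bdry G r.1) r.2 ∧ r.2.length ≠ 1) ∧
      time ≤ t * (10 * min k D) := by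
  intro t
  induction t with
  | zero => intro In f _ h1 h2; omega
  | succ t ih =>
    intro In f hIn h1 h2 hf
    have hm : 1 ≤ min k D := by omega
    rw [chain.eq_def]
    dsimp only
    refine Run.silent_op_bind ?_
    by_cases hlen : f.length = 1
    · simp only [hlen, decide_true, if_true]
      obtain ⟨v, rfl⟩ := List.length_eq_one_iff.1 hlen
      have hv : Bdry G In v := hf.mem v (by simp)
      have huniq : ∀ w, Bdry G In w → w = v := fun w hw => by simpa using hf.all (by simp) w hw
      have hroot := hIn.cons hv (by omega)
      have hsol : ∀ S, Solution G k In S → Solution G k (v :: In) S := fun S hS => by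
        obtain ⟨w, hw, hw'⟩ := hS.exists_bdry hIn.ne_nil (by omega)
        exact solution_cons.2 ⟨hS, huniq w hw' ▸ hw⟩
      simp only
      refine Run.silent_op_bind ?_
      refine Run.silent_op_bind ?_
      by_cases hk1 : (v :: In).length = k - 1
      · simp only [hk1, decide_true, if_true]
        refine Run.silent_pure ⟨hroot, by simp +contextual, hk1.le, hsol, by tauto, ?_⟩
        rw [Nat.succ_mul]
        omega
      · simp only [hk1, decide_false, Bool.false_eq_true, if_false]
        have hbd : ∀ w, (False ∨ w ∈ A v ∧ w ∉ v :: In) ↔ Bdry G (v :: In) w := by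
          intro w
          simp only [(hA v).2, Bdry, List.mem_cons, or_and_right, exists_or, exists_eq_left]
          constructor
          · tauto
          · rintro ⟨h3, h4 | h4⟩
            · tauto
            · exact absurd (.inl (huniq w ⟨fun h => h3 (.inr h), h4⟩)) h3
        refine (scanTwo_time (In := v :: In) (p := fun _ => False) (k := k) (D := D)
          ⟨by simp, by simp, by simp, by simp⟩ (hA v).1 hroot.length_le hk (hD v)).bind ?_
        rintro f' t' ⟨hf', ht'⟩
        simp only [List.length_cons] at hk1
        refine (ih (v :: In) f' hroot (by simp; omega) (by simp; omega) (hf'.congr hbd)).mono ?_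
        rintro r t'' ⟨r1, r2, r3, r4, r5, r6⟩
        refine ⟨r1, fun x hx => r2 x (by simp [hx]), r3, fun S hS => r4 S (hsol S hS), r5, ?_⟩
        rw [Nat.succ_mul]
        omega
    · simp only [hlen, decide_false, Bool.false_eq_true, if_false]
      refine Run.silent_pure ⟨hIn, fun x => id, h1.le, fun S => id, fun _ => ⟨hf, hlen⟩, ?_⟩
      rw [Nat.succ_mul]
      omega

end Subroutines

/-! ### Testing a single vertex and writing the output -/

section Mandatory

variable {V : Type} [DecidableEq V]

/-- Every entry that is scanned, except for one at most, ends up in `v :: s'.seen`, which has at most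
`k + 1` elements; this gives a time bound that does not depend on the length of the list. -/
theorem bfsScan_spec {k : ℕ} {v : V} : ∀ (L : List V) (s : Bfs V), s.seen.length ≤ k → s.seen.Nodup →
    (bfsScan k v L s).Silent fun s' t => ∃ new : List V, s'.seen = new.reverse ++ s.seen ∧
      s'.queue = s.queue ++ new ∧ (∀ x ∈ new, x ∈ L ∧ x ≠ v) ∧ s'.seen.length ≤ k ∧
      s'.seen.Nodup ∧ (s'.seen.length < k → ∀ x ∈ L, x = v ∨ x ∈ s'.seen) ∧
      t ≤ 3 * L.length ∧ t ≤ 3 * (L.filter (· ∈ v :: s'.seen)).length + 1 := by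
  intro L
  induction L with
  | nil =>
    intro s hs hn
    exact Run.silent_pure ⟨[], by simp, by simp, by simp, hs, hn, by simp, by simp, by simp⟩
  | cons w ws ih =>
    intro s hs hn
    rw [bfsScan]
    refine Run.silent_op_bind ?_
    by_cases hk : k ≤ s.seen.length
    · simp only [hk, decide_true, if_true]
      exact Run.silent_pure ⟨[], by simp, by simp, by simp, hs, hn, fun h => by omega,
        by simp; omega, by omega⟩
    · simp only [hk, decide_false, Bool.false_eq_true, if_false]
      refine Run.silent_op_bind ?_
      by_cases hw : w = v ∨ w ∈ s.seen
      · simp only [hw, decide_true, if_true]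
        refine (ih s hs hn).mono ?_
        rintro s' t ⟨new, h1, h2, h3, h4, h5, h6, h7, h8⟩
        have hw' : w ∈ v :: s'.seen := by simp [h1]; tauto
        refine ⟨new, h1, h2, fun x hx => ⟨by simp [h3 x hx], (h3 x hx).2⟩, h4, h5, fun h => ?_,
          by simp; omega, ?_⟩
        · rw [List.forall_mem_cons]
          exact ⟨by simpa using hw', h6 h⟩
        · rw [List.filter_cons_of_pos (by simpa using hw'), List.length_cons]
          omega
      · simp only [hw, decide_false, Bool.false_eq_true, if_false]
        push Not at hw
        refine Run.silent_op_bind ((ih ⟨w :: s.seen, s.queue ++ [w]⟩ (by simp; omega)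
          (by simp [hn, hw.2])).mono ?_)
        rintro s' t ⟨new, h1, h2, h3, h4, h5, h6, h7, h8⟩
        have hw' : w ∈ v :: s'.seen := by simp [h1]
        refine ⟨w :: new, by simp [h1], by simp [h2], ?_, h4, h5, fun h => ?_, by simp; omega, ?_⟩
        · rw [List.forall_mem_cons]
          exact ⟨⟨by simp, hw.1⟩, fun x hx => ⟨by simp [h3 x hx], (h3 x hx).2⟩⟩
        · rw [List.forall_mem_cons]
          exact ⟨by simpa using hw', h6 h⟩
        · rw [List.filter_cons_of_pos (by simpa using hw'), List.length_cons]
          omega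

/-- Invariants of the breadth-first search from `In` that avoids `v`. -/
structure BfsInv (G : SimpleGraph V) (In : List V) (k : ℕ) (v : V) (s : Bfs V) : Prop where
  nodup : s.seen.Nodup
  root : ∀ x ∈ In, x ∈ s.seen
  reach : ∀ x ∈ s.seen, Reach (G.deleteIncidenceSet v) In x
  le : s.seen.length ≤ k
  queue : ∀ x ∈ s.queue, x ∈ s.seen
  closed : s.seen.length < k → ∀ x ∈ s.seen, x ∉ s.queue → ∀ y, G.Adj x y → y = v ∨ y ∈ s.seen

/-- The hypothesis on the lengths says that `k - t` vertices have been expanded.  Hence, when the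
fuel is used up, `k` vertices have been seen. -/
theorem bfsLoop_spec {G : SimpleGraph V} {A : V → List V} {In : List V} {k D : ℕ} {v : V}
    (hA : IsAdjList G A) (hv : v ∉ In) (hk : 2 ≤ k) (hD : ∀ v, (A v).length ≤ D) :
    ∀ (t : ℕ) (s : Bfs V), BfsInv G In k v s → s.seen.length + t = s.queue.length + k →
    (bfsLoop A k v t s).Silent fun s' time => BfsInv G In k v s' ∧
      (s'.seen.length < k → s'.queue = []) ∧ time ≤ t * (1 + 5 * min k D) := by
  intro t
  induction t with
  | zero =>
    intro s hs hq
    exact Run.silent_pure ⟨hs, fun h => by omega, by simp⟩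
  | succ t ih =>
    intro s hs hq
    rw [bfsLoop]
    refine Run.silent_op_bind ?_
    by_cases hks : k ≤ s.seen.length
    · simp only [hks, decide_true, if_true]
      refine Run.silent_pure ⟨hs, fun h => by omega, ?_⟩
      rw [Nat.succ_mul]; omega
    · simp only [hks, decide_false, Bool.false_eq_true, if_false]
      split
      · next hnil =>
        refine Run.silent_pure ⟨hs, fun _ => hnil, ?_⟩
        rw [Nat.succ_mul]; omega
      · next w q hwq =>
        refine (bfsScan_spec (A w) ⟨s.seen, q⟩ hs.le hs.nodup).bind ?_
        rintro s' t' ⟨new, h1, h2, h3, h4, h5, h6, h7, h8⟩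
        dsimp only at h1 h2
        have hws : w ∈ s.seen := hs.queue w (by simp [hwq])
        have hsub : ∀ x ∈ s.seen, x ∈ s'.seen := fun x hx => by simp [h1, hx]
        have hinv : BfsInv G In k v s' := by
          refine ⟨h5, fun x hx => hsub x (hs.root x hx), fun x hx => ?_, h4, fun x hx => ?_,
            fun hlt x hx hxq y hxy => ?_⟩
          · simp only [h1, List.mem_append, List.mem_reverse] at hx
            rcases hx with hx | hx
            · exact (hs.reach w hws).step_delete hv (((hA w).2 x).1 (h3 x hx).1) (h3 x hx).2
            · exact hs.reach x hx
          · simp only [h2, List.mem_append] at hx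
            rcases hx with hx | hx
            · exact hsub x (hs.queue x (by simp [hwq, hx]))
            · simp [h1, hx]
          · simp only [h1, h2, List.mem_append, List.mem_reverse, not_or] at hx hxq
            rcases eq_or_ne x w with rfl | hxw
            · exact h6 hlt y (((hA x).2 y).2 hxy)
            · have := hs.closed (by omega) x (by tauto) (by simp [hwq, hxw, hxq.1]) y hxy
              exact this.imp_right (hsub y)
        have hlen : s'.seen.length + t = s'.queue.length + k := by
          simp only [h1, h2, List.length_append, List.length_reverse]
          rw [hwq, List.length_cons] at hq
          omega
        refine (ih s' hinv hlen).mono ?_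
        rintro s'' t'' ⟨h9, h10, h11⟩
        refine ⟨h9, h10, ?_⟩
        have h12 : t' ≤ 5 * min k D := by
          refine le_mul_min ?_ (by have := hD w; omega)
          have := length_filter_mem_le (M := v :: s'.seen) (hA w).1
          rw [List.length_cons] at this
          omega
        rw [Nat.succ_mul]; omega

theorem isMandatory_spec [Fintype V] {G : SimpleGraph V} {A : V → List V} {In : List V} {k D : ℕ}
    {v : V} (hA : IsAdjList G A) (hIn : IsRoot G k In) (hv : v ∉ In) (hk : 2 ≤ k)
    (hD : ∀ v, (A v).length ≤ D) (hD1 : 1 ≤ D) :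
    (isMandatory A In k v).Silent fun b t => (b = true ↔ Mandatory G In k v) ∧
      t ≤ 9 * (k * min k D) := by
  have hm : 1 ≤ min k D := by omega
  unfold isMandatory
  refine Run.silent_charge_bind ?_
  refine (bfsLoop_spec hA hv hk hD k ⟨In, In⟩ ⟨hIn.nodup, fun _ => id, fun _ => .base,
    hIn.length_le, fun _ => id, fun _ x h1 h2 => absurd h1 h2⟩ rfl).bind ?_
  rintro s t ⟨hs, h1, h2⟩
  refine Run.silent_charge_bind (Run.silent_op ⟨?_, ?_⟩)
  · rw [decide_eq_true_iff]
    rw [← List.toFinset_card_of_nodup hs.nodup, Mandatory]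
    constructor
    · intro h
      refine lt_of_le_of_lt (Finset.card_le_card fun w hw => ?_) h
      rw [List.toFinset_card_of_nodup hs.nodup] at h
      rw [List.mem_toFinset]
      refine (mem_component.1 hw).closed (p := (· ∈ s.seen)) hs.root fun a b ha hab => ?_
      rw [SimpleGraph.deleteIncidenceSet_adj] at hab
      exact (hs.closed h a ha (by simp [h1 h]) b hab.1).resolve_left hab.2.2
    · refine lt_of_le_of_lt (Finset.card_le_card fun w hw => ?_)
      rw [List.mem_toFinset] at hw
      exact mem_component.2 (hs.reach w hw)
  · have h3 := hIn.length_le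
    have h4 := hs.le
    have h5 : k ≤ k * min k D := Nat.le_mul_of_pos_right k hm
    rw [Nat.mul_add, Nat.mul_left_comm] at h2
    omega

theorem pickNonMandatory_spec [Fintype V] {G : SimpleGraph V} {A : V → List V} {In : List V}
    {k D : ℕ} {x y : V} (hA : IsAdjList G A) (hIn : IsRoot G k In) (hx : x ∉ In) (hy : y ∉ In)
    (hk : 2 ≤ k) (hD : ∀ v, (A v).length ≤ D) (hD1 : 1 ≤ D) :
    (pickNonMandatory A In k x y).Silent fun c t =>
      (∀ z, c = some z → (z = x ∨ z = y) ∧ ¬ Mandatory G In k z) ∧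
      (c = none → Mandatory G In k x ∧ Mandatory G In k y) ∧ t ≤ 18 * (k * min k D) := by
  unfold pickNonMandatory
  refine (isMandatory_spec hA hIn hx hk hD hD1).bind ?_
  rintro b t ⟨hb, ht⟩
  by_cases hbx : b = true
  · simp only [hbx, if_true]
    refine (isMandatory_spec hA hIn hy hk hD hD1).bind ?_
    rintro b' t' ⟨hb', ht'⟩
    by_cases hby : b' = true
    · simp only [hby, if_true]
      exact Run.silent_pure ⟨by simp, fun _ => ⟨hb.1 hbx, hb'.1 hby⟩, by omega⟩
    · simp only [hby, Bool.false_eq_true, if_false]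
      refine Run.silent_pure ⟨?_, by simp, by omega⟩
      rintro z ⟨⟩
      exact ⟨.inr rfl, fun h => hby (hb'.2 h)⟩
  · simp only [hbx, Bool.false_eq_true, if_false]
    refine Run.silent_pure ⟨?_, by simp, by omega⟩
    rintro z ⟨⟩
    exact ⟨.inl rfl, fun h => hbx (hb.2 h)⟩

/-- The output `out` lists every connected `k`-set that contains `In` exactly once. -/
def Enumerates (out : List (List V)) (G : SimpleGraph V) (k : ℕ) (In : List V) : Prop :=
  (out.map List.toFinset).Nodup ∧ ∀ S, S ∈ out.map List.toFinset ↔ Solution G k In S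

/-- The exact output and running time of `outputAll`, where `seen` lists `N(In)`. -/
theorem outputAll_run {G : SimpleGraph V} {A : V → List V} {In : List V} (hA : IsAdjList G A) :
    ∃ seen : List V, seen.Nodup ∧ (∀ w, w ∈ seen ↔ Bdry G In w) ∧
      (outputAll A In).out = seen.reverse.map (· :: In) ∧
      (outputAll A In).time = In.length + (In.map fun a => (A a).length).sum +
        seen.length * (In.length + 3) := by
  have inner : ∀ (L seen₀ : List V), seen₀.Nodup → L.Nodup →
      let r := L.foldlM (m := Run V) (fun seen w => do
        if ← op (decide (w ∈ In ∨ w ∈ seen)) then pure seen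
        else
          emit (w :: In)
          op (w :: seen)) seen₀
      ∃ new, r.val = new ++ seen₀ ∧ r.val.Nodup ∧
        (∀ w, w ∈ r.val ↔ w ∈ seen₀ ∨ w ∈ L ∧ w ∉ In) ∧ r.out = new.reverse.map (· :: In) ∧
        r.time = L.length + new.length * (In.length + 2) := by
    intro L seen₀ hs hL
    refine Run.foldlM_induction (fun pre a o t => ∃ new, a = new ++ seen₀ ∧ a.Nodup ∧
        (∀ w, w ∈ a ↔ w ∈ seen₀ ∨ w ∈ pre ∧ w ∉ In) ∧ o = new.reverse.map (· :: In) ∧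
        t = pre.length + new.length * (In.length + 2)) ⟨[], by simpa using hs⟩ ?_
    rintro pre w suf a o t - ⟨new, h1, h2, h3, h4, h5⟩
    by_cases hw : w ∈ In ∨ w ∈ a
    · refine ⟨new, by simpa [hw] using h1, by simpa [hw] using h2, fun u => ?_, by simp [hw, h4], ?_⟩
      · simp only [hw, Run.val_bind, Run.val_op, decide_true, if_true, Run.val_pure]
        rw [h3 u, List.mem_append, List.mem_singleton]
        constructor
        · tauto
        · rintro (h | ⟨h | rfl, h'⟩)
          · exact .inl h
          · exact .inr ⟨h, h'⟩
          · exact (h3 u).1 (hw.resolve_left h')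
      · simp [hw, h5]
        omega
    · refine ⟨w :: new, by simpa [hw] using h1, ?_, fun u => ?_, by simp [hw, h4], ?_⟩
      · simp [hw]; tauto
      · simp only [hw, Run.val_bind, Run.val_op, decide_false, Bool.false_eq_true, if_false]
        rw [List.mem_cons, h3 u, List.mem_append, List.mem_singleton]
        push Not at hw
        constructor
        · rintro (rfl | h | h)
          · exact .inr ⟨.inr rfl, hw.1⟩
          · exact .inl h
          · exact .inr ⟨.inl h.1, h.2⟩
        · tauto
      · simp [hw, h5, Nat.succ_mul]
        omega
  have outer := Run.foldlM_induction (V := V) (l := In) (a := ([] : List V))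
    (f := fun seen v => do
      let nbrs ← op (A v)
      nbrs.foldlM (fun seen w => do
        if ← op (decide (w ∈ In ∨ w ∈ seen)) then pure seen
        else
          emit (w :: In)
          op (w :: seen)) seen)
    (fun pre a o t => a.Nodup ∧ (∀ w, w ∈ a ↔ w ∉ In ∧ ∃ b ∈ pre, G.Adj b w) ∧
      o = a.reverse.map (· :: In) ∧
      t = pre.length + (pre.map fun a => (A a).length).sum + a.length * (In.length + 2))
    (by simp) (by
      rintro pre v suf a o t - ⟨h1, h2, h3, h4⟩
      obtain ⟨new, i1, i2, i3, i4, i5⟩ := inner (A v) a h1 (hA v).1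
      rw [Run.val_bind, Run.out_bind, Run.time_bind, Run.val_op, Run.out_op, Run.time_op]
      refine ⟨i2, fun w => ?_, ?_, ?_⟩
      · rw [i3, h2, (hA v).2]
        simp only [List.mem_append, List.mem_singleton, or_and_right, exists_or, exists_eq_left]
        rw [and_comm (b := w ∉ In), ← and_or_left]
      · rw [i4, i1, h3]; simp
      · rw [i5, i1, h4]
        simp [Nat.add_mul]
        omega)
  obtain ⟨h1, h2, h3, h4⟩ := outer
  refine ⟨_, h1, fun w => (h2 w).trans Iff.rfl, ?_, ?_⟩
  · unfold outputAll
    rw [Run.out_bind, h3]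
    simp
  · unfold outputAll
    rw [Run.time_bind, h4, Run.time_charge, Nat.mul_succ _ (In.length + 2)]
    omega

theorem solution_iff_of_length {G : SimpleGraph V} {k : ℕ} {In : List V} (hIn : IsRoot G k In)
    (hk : In.length + 1 = k) {S : Finset V} :
    Solution G k In S ↔ ∃ w, Bdry G In w ∧ S = (w :: In).toFinset := by
  constructor
  · intro h
    obtain ⟨w, hwS, hw⟩ := h.exists_bdry hIn.ne_nil (by omega)
    refine ⟨w, hw, (Finset.eq_of_subset_of_card_le (fun x hx => ?_) ?_).symm⟩
    · rw [List.mem_toFinset, List.mem_cons] at hx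
      rcases hx with rfl | hx
      · exact hwS
      · exact h.2.1 x hx
    · rw [List.toFinset_card_of_nodup (by simp [hw.1, hIn.nodup]), h.1, List.length_cons, hk]
  · rintro ⟨w, hw, rfl⟩
    refine ⟨?_, fun x hx => by simp [hx], ?_⟩
    · rw [List.toFinset_card_of_nodup (by simp [hw.1, hIn.nodup]), List.length_cons, hk]
    · convert hIn.linked.cons hw.2 using 1
      ext x
      simp

theorem outputAll_spec {G : SimpleGraph V} {A : V → List V} {In : List V} {k D : ℕ}
    (hA : IsAdjList G A) (hIn : IsRoot G k In) (hk : In.length + 1 = k)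
    (hD : ∀ v, (A v).length ≤ D) (hD1 : 1 ≤ D) :
    Enumerates (outputAll A In).out G k In ∧ ((outputAll A In).out ≠ [] →
      (outputAll A In).time ≤ 6 * (k * min k D) * (outputAll A In).out.length) := by
  obtain ⟨seen, h1, h2, h3, h4⟩ := outputAll_run (In := In) hA
  rw [h3, h4]
  refine ⟨⟨?_, fun S => ?_⟩, fun hne => ?_⟩
  · rw [List.map_map]
    refine (List.nodup_reverse.2 h1).map_on fun x hx y hy hxy => ?_
    rw [List.mem_reverse, h2] at hx hy
    have : x ∈ (y :: In).toFinset := by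
      rw [← show (x :: In).toFinset = (y :: In).toFinset from hxy]; simp
    simpa [hx.1] using this
  · rw [solution_iff_of_length hIn hk]
    simp only [List.map_map, List.mem_map, List.mem_reverse, h2, Function.comp_apply]
    exact exists_congr fun w => and_congr_right fun _ => eq_comm
  · have hm : 1 ≤ min k D := by omega
    rw [List.length_map, List.length_reverse]
    have hN : 1 ≤ seen.length := by
      rw [Nat.one_le_iff_ne_zero, Ne, List.length_eq_zero_iff]
      rintro rfl
      simp at hne
    have hsum : (In.map fun a => (A a).length).sum ≤ k * (2 * seen.length * min k D) := by
      refine (List.sum_le_card_nsmul _ (2 * seen.length * min k D) fun x hx => ?_).trans ?_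
      · obtain ⟨a, ha, rfl⟩ := List.mem_map.1 hx
        refine le_mul_min ?_ (by have := hD a; nlinarith)
        have : (A a).length ≤ (In ++ seen).length :=
          length_le_of_nodup_subset (hA a).1 fun w hw => by
            rw [List.mem_append, h2, Bdry]
            by_cases hw' : w ∈ In
            · exact .inl hw'
            · exact .inr ⟨hw', a, ha, ((hA a).2 w).1 hw⟩
        rw [List.length_append] at this
        nlinarith
      · rw [List.length_map, smul_eq_mul]
        exact Nat.mul_le_mul_right _ hIn.length_le
    have h5 : k ≤ k * min k D := Nat.le_mul_of_pos_right k hm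
    have h6 : k * min k D ≤ k * min k D * seen.length := Nat.le_mul_of_pos_right _ hN
    have h7 : seen.length * (In.length + 3) ≤ 3 * (k * min k D * seen.length) := by
      have : In.length + 3 ≤ 3 * k := by
        have : 1 ≤ In.length := List.length_pos_iff.2 hIn.ne_nil
        omega
      nlinarith
    have h8 : k * (2 * seen.length * min k D) = 2 * (k * min k D * seen.length) := by ring
    have h9 : 6 * (k * min k D) * seen.length = 6 * (k * min k D * seen.length) := by ring
    omega

end Mandatory

/-! ### The lowpoint search -/

section DepthFirst

variable {V : Type}

/-- A certificate that `u` separates exactly `c` of the vertices in `P` from `In`: a set `K` of `c`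
vertices of `P` that can be left only through `u`, while all other vertices of `P` are reachable
from `In` without `u`.  All neighbours of `u` lie in `P`, so that the certificate survives when
the search goes on. -/
structure CutCert (G : SimpleGraph V) (In P : List V) (u : V) (c : ℕ) : Prop where
  mem : u ∈ P
  nbrs : ∀ y, G.Adj u y → y ∈ P
  cut : ∃ K : Finset V, K.card = c ∧ u ∉ K ∧ (∀ x ∈ K, x ∈ P ∧ x ∉ In) ∧
    (∀ x ∈ K, ∀ y, G.Adj x y → y ∈ K ∨ y = u) ∧
    ∀ x ∈ P, x ∉ K → x ≠ u → Reach (G.deleteIncidenceSet u) In x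

theorem CutCert.cons {G : SimpleGraph V} {In P : List V} {u v p : V} {c : ℕ}
    (h : CutCert G In P u c) (hu : u ∉ In) (hv : v ∉ P) (hp : p ∈ P) (hpv : G.Adj p v) :
    CutCert G In (v :: P) u c := by
  obtain ⟨h1, h2, K, h3, h4, h5, h6, h7⟩ := h
  refine ⟨.tail _ h1, fun y hy => .tail _ (h2 y hy), K, h3, h4,
    fun x hx => ⟨.tail _ (h5 x hx).1, (h5 x hx).2⟩, h6, fun x hx hxK hxu => ?_⟩
  rcases List.mem_cons.1 hx with rfl | hx
  · refine (h7 p hp (fun hpK => ?_) ?_).step_delete hu hpv hxu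
    · exact (h6 p hpK x hpv).elim hxK hxu
    · rintro rfl
      exact hv (h2 x hpv)
  · exact h7 x hx hxK hxu

/-- Invariants of the search state: all vertices seen are reachable from `In` inside the set of
the vertices seen, and the discovery numbers are smaller than the number of vertices seen. -/
structure DfsInv (G : SimpleGraph V) (In : List V) (s : Dfs V) : Prop where
  nodup : s.seen.Nodup
  root : ∀ x ∈ In, x ∈ s.seen
  reach : ∀ p ∈ s.seen, ∀ u, u ∉ s.seen → Reach (G.deleteIncidenceSet u) In p
  component : ∀ p ∈ s.seen, Reach G In p
  disc : ∀ p ∈ s.seen, s.disc p < s.seen.length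

/-- The time spent on the vertices in `L` by the search. -/
def weight (A : V → List V) (L : List V) : ℕ :=
  (L.map fun u => 3 + 2 * (A u).length).sum

@[simp] theorem weight_nil (A : V → List V) : weight A [] = 0 := rfl

@[simp] theorem weight_cons (A : V → List V) (u : V) (L : List V) :
    weight A (u :: L) = 3 + 2 * (A u).length + weight A L := rfl

@[simp] theorem weight_append (A : V → List V) (L M : List V) :
    weight A (L ++ M) = weight A L + weight A M := by
  simp [weight]

/-- What the search from `v` in state `s` achieves: `T` lists the vertices of the subtree of `v`,
and the lowpoint is the least discovery number of `v` and of the neighbours of `T` outside `T`. -/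
structure DfsPost (G : SimpleGraph V) (A : V → List V) (In : List V) (v : V) (s : Dfs V)
    (r : DfsAcc V) (time : ℕ) (T : List V) : Prop where
  seen : r.state.seen = T ++ s.seen
  inv : DfsInv G In r.state
  mem : v ∈ T
  size : r.size = T.length
  disc_old : ∀ p ∈ s.seen, r.state.disc p = s.disc p
  cut_old : ∀ p ∈ s.seen, r.state.cut p = s.cut p
  disc_new : ∀ u ∈ T, s.seen.length ≤ r.state.disc u
  closed : ∀ u ∈ T, ∀ y, G.Adj u y → y ∈ r.state.seen
  linked : Linked G {x | x ∈ T}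
  low_le : r.low ≤ s.seen.length
  low_lower : ∀ u ∈ T, ∀ p ∈ s.seen, G.Adj u p → r.low ≤ s.disc p
  low_attained : r.low = s.seen.length ∨ ∃ u ∈ T, ∃ p ∈ s.seen, G.Adj u p ∧ r.low = s.disc p
  cert_old : ∀ u c, u ∉ In → CutCert G In s.seen u c → CutCert G In r.state.seen u c
  cert_new : ∀ u ∈ T, CutCert G In r.state.seen u (r.state.cut u)
  time_le : time ≤ weight A T

/-- Invariants of the scan of the adjacency list of `v`: `pre` is the part scanned so far, and
`seg` lists the vertices of the subtrees of the children of `v` found so far. -/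
structure DfsScan (G : SimpleGraph V) (A : V → List V) (In : List V) (v : V) (s : Dfs V)
    (pre : List V) (a : DfsAcc V) (time : ℕ) (seg : List V) : Prop where
  seen : a.state.seen = seg ++ v :: s.seen
  inv : DfsInv G In a.state
  size : a.size = seg.length + 1
  disc_old : ∀ p ∈ s.seen, a.state.disc p = s.disc p
  disc_self : a.state.disc v = s.seen.length
  cut_old : ∀ p ∈ s.seen, a.state.cut p = s.cut p
  disc_new : ∀ u ∈ seg, s.seen.length < a.state.disc u
  closed : ∀ u ∈ seg, ∀ y, G.Adj u y → y ∈ a.state.seen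
  scanned : ∀ w ∈ pre, w ∈ a.state.seen
  linked : Linked G {x | x ∈ v :: seg}
  low_le : a.low ≤ s.seen.length
  low_lower : ∀ u ∈ seg, ∀ p ∈ s.seen, G.Adj u p → a.low ≤ s.disc p
  low_lower_self : ∀ p ∈ pre, p ∈ s.seen → a.low ≤ s.disc p
  low_attained : a.low = s.seen.length ∨
    ∃ u ∈ v :: seg, ∃ p ∈ s.seen, G.Adj u p ∧ a.low = s.disc p
  cert_old : ∀ u c, u ∉ In → CutCert G In s.seen u c → CutCert G In a.state.seen u c
  cert_new : ∀ u ∈ seg, CutCert G In a.state.seen u (a.state.cut u)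
  cut : ∃ K : Finset V, K.card = a.cut ∧ (∀ x ∈ K, x ∈ seg) ∧
    (∀ x ∈ K, ∀ y, G.Adj x y → y ∈ K ∨ y = v) ∧
    ∀ x ∈ seg, x ∉ K → Reach (G.deleteIncidenceSet v) In x
  time_le : time ≤ weight A seg + 2 * pre.length

variable [DecidableEq V]

theorem DfsScan.start {G : SimpleGraph V} {A : V → List V} {In : List V} {v p : V} {s : Dfs V}
    (hs : DfsInv G In s) (hv : v ∉ s.seen) (hp : p ∈ s.seen) (hpv : G.Adj p v) :
    DfsScan G A In v s []
      ⟨⟨v :: s.seen, Function.update s.disc v s.seen.length, s.cut⟩, s.seen.length, 1, 0⟩ 0 [] where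
  seen := rfl
  inv := by
    refine ⟨by simp [hv, hs.nodup], fun x hx => .tail _ (hs.root x hx), fun x hx u hu => ?_,
      fun x hx => ?_, fun x hx => ?_⟩
    · rw [List.mem_cons, not_or] at hu
      rcases List.mem_cons.1 hx with rfl | hx
      · exact (hs.reach p hp u hu.2).step_delete (fun h => hu.2 (hs.root u h)) hpv (Ne.symm hu.1)
      · exact hs.reach x hx u hu.2
    · rcases List.mem_cons.1 hx with rfl | hx
      · exact (hs.component p hp).step hpv
      · exact hs.component x hx
    · rcases List.mem_cons.1 hx with rfl | hx'
      · simp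
      · have hxv : x ≠ v := by rintro rfl; exact hv hx'
        have := hs.disc x hx'
        simp only [Function.update_of_ne hxv, List.length_cons]
        omega
  size := rfl
  disc_old := fun x hx => Function.update_of_ne (by rintro rfl; exact hv hx) _ _
  disc_self := Function.update_self _ _ _
  cut_old := fun _ _ => rfl
  disc_new := by simp
  closed := by simp
  scanned := by simp
  linked := by simpa using linked_singleton G v
  low_le := le_rfl
  low_lower := by simp
  low_lower_self := by simp
  low_attained := .inl rfl
  cert_old := fun u c hu h => h.cons hu hv hp hpv
  cert_new := by simp
  cut := ⟨∅, by simp⟩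
  time_le := by simp

theorem DfsScan.skip {G : SimpleGraph V} {A : V → List V} {In : List V} {v w : V} {s : Dfs V}
    {pre seg : List V} {a : DfsAcc V} {t : ℕ} (h : DfsScan G A In v s pre a t seg)
    (hv : v ∉ s.seen) (hvw : G.Adj v w) (hw : w ∈ a.state.seen) :
    DfsScan G A In v s (pre ++ [w]) ⟨a.state, min a.low (a.state.disc w), a.size, a.cut⟩ (t + 2)
      seg where
  seen := h.seen
  inv := h.inv
  size := h.size
  disc_old := h.disc_old
  disc_self := h.disc_self
  cut_old := h.cut_old
  disc_new := h.disc_new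
  closed := h.closed
  scanned := by
    intro u hu
    rcases List.mem_append.1 hu with hu | hu
    · exact h.scanned u hu
    · rwa [List.mem_singleton.1 hu]
  linked := h.linked
  low_le := (min_le_left _ _).trans h.low_le
  low_lower := fun u hu p hp hup => (min_le_left _ _).trans (h.low_lower u hu p hp hup)
  low_lower_self := by
    intro p hp hps
    rcases List.mem_append.1 hp with hp | hp
    · exact (min_le_left _ _).trans (h.low_lower_self p hp hps)
    · rw [List.mem_singleton.1 hp] at hps ⊢
      exact (min_le_right _ _).trans (h.disc_old w hps).le
  low_attained := by
    by_cases hlt : a.low ≤ a.state.disc w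
    · simpa only [min_eq_left hlt] using h.low_attained
    · rw [not_le] at hlt
      right
      have hws : w ∈ s.seen := by
        rw [h.seen, List.mem_append, List.mem_cons] at hw
        rcases hw with hw | rfl | hw
        · have := h.disc_new w hw
          have := h.low_le
          omega
        · exact absurd rfl hvw.ne
        · exact hw
      exact ⟨v, List.mem_cons_self, w, hws, hvw, by
        simp only [min_eq_right hlt.le]; exact h.disc_old w hws⟩
  cert_old := h.cert_old
  cert_new := h.cert_new
  cut := h.cut
  time_le := by
    have := h.time_le
    simp
    omega

/-- A child subtree that is finished either can be left only through `v`, namely if its lowpoint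
is at least the discovery number of `v`, or is reachable from `In` without `v`. -/
theorem DfsScan.child {G : SimpleGraph V} {A : V → List V} {In : List V} {v w : V} {s : Dfs V}
    {pre seg T : List V} {a b : DfsAcc V} {t t' : ℕ} (h : DfsScan G A In v s pre a t seg)
    (hs : DfsInv G In s) (hv : v ∉ s.seen) (hvw : G.Adj v w)
    (hb : DfsPost G A In w a.state b t' T) :
    DfsScan G A In v s (pre ++ [w]) ⟨b.state, min a.low b.low, a.size + b.size,
      if s.seen.length ≤ b.low then a.cut + b.size else a.cut⟩ (t + t' + 2) (T ++ seg) := by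
  have hmem : ∀ x, x ∈ a.state.seen ↔ x ∈ seg ∨ x = v ∨ x ∈ s.seen := by simp [h.seen]
  have hmemb : ∀ x, x ∈ b.state.seen ↔ x ∈ T ∨ x ∈ a.state.seen := by simp [hb.seen]
  have hdisj : ∀ x ∈ T, x ∉ a.state.seen := by
    have := hb.inv.nodup
    rw [hb.seen, List.nodup_append'] at this
    exact fun x hx hx' => this.2.2 hx hx'
  have hTn : T.Nodup := by
    have := hb.inv.nodup
    rw [hb.seen] at this
    exact this.of_append_left
  have hvIn : v ∉ In := fun hx => hv (hs.root v hx)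
  have hlen : s.seen.length < a.state.seen.length := by simp [h.seen]; omega
  -- a lowpoint below the discovery number of `v` comes from a vertex seen before `v`
  have hback : b.low < s.seen.length →
      ∃ u ∈ T, ∃ p ∈ s.seen, G.Adj u p ∧ b.low = s.disc p := by
    intro hlt
    rcases hb.low_attained with h1 | ⟨u, hu, p, hp, hup, h1⟩
    · omega
    · rcases (hmem p).1 hp with h2 | rfl | h2
      · have := h.disc_new p h2; omega
      · have := h.disc_self; omega
      · exact ⟨u, hu, p, h2, hup, by rw [h1, h.disc_old p h2]⟩
  refine ⟨by rw [hb.seen, h.seen, List.append_assoc], hb.inv, ?_, fun p hp => ?_, ?_,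
    fun p hp => ?_, fun u hu => ?_, fun u hu y hy => ?_, fun u hu => ?_, ?_,
    (min_le_left _ _).trans h.low_le, fun u hu p hp hup => ?_, fun p hp hps => ?_, ?_,
    fun u c hu hc => hb.cert_old u c hu (h.cert_old u c hu hc), fun u hu => ?_, ?_, ?_⟩
  · simp only [h.size, hb.size, List.length_append]; omega
  · rw [hb.disc_old p ((hmem p).2 (.inr (.inr hp))), h.disc_old p hp]
  · rw [hb.disc_old v ((hmem v).2 (.inr (.inl rfl))), h.disc_self]
  · rw [hb.cut_old p ((hmem p).2 (.inr (.inr hp))), h.cut_old p hp]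
  · rcases List.mem_append.1 hu with hu | hu
    · exact hlen.trans_le (hb.disc_new u hu)
    · have := h.disc_new u hu
      rwa [← hb.disc_old u ((hmem u).2 (.inl hu))] at this
  · rcases List.mem_append.1 hu with hu | hu
    · exact hb.closed u hu y hy
    · exact (hmemb y).2 (.inr (h.closed u hu y hy))
  · rcases List.mem_append.1 hu with hu | hu
    · exact (hmemb u).2 (.inr (h.scanned u hu))
    · rw [List.mem_singleton.1 hu]
      exact (hmemb w).2 (.inl hb.mem)
  · have := h.linked.union hb.linked (a := v) (b := w) (by simp) hb.mem hvw
    convert this using 1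
    ext x
    simp
    tauto
  · rcases List.mem_append.1 hu with hu | hu
    · refine (min_le_right _ _).trans ?_
      have hp' := (hmem p).2 (.inr (.inr hp))
      exact (hb.low_lower u hu p hp' hup).trans (h.disc_old p hp).le
    · exact (min_le_left _ _).trans (h.low_lower u hu p hp hup)
  · rcases List.mem_append.1 hp with hp | hp
    · exact (min_le_left _ _).trans (h.low_lower_self p hp hps)
    · rw [List.mem_singleton.1 hp] at hps
      exact absurd ((hmem w).2 (.inr (.inr hps))) (hdisj w hb.mem)
  · by_cases hle : a.low ≤ b.low
    · simp only [min_eq_left hle]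
      refine h.low_attained.imp_right ?_
      rintro ⟨u, hu, p, hp, hup⟩
      exact ⟨u, by simp at hu ⊢; tauto, p, hp, hup⟩
    · rw [not_le] at hle
      have := h.low_le
      obtain ⟨u, hu, p, hp, hup⟩ := hback (by omega)
      simp only [min_eq_right hle.le]
      exact .inr ⟨u, by simp [hu], p, hp, hup⟩
  · rcases List.mem_append.1 hu with hu | hu
    · exact hb.cert_new u hu
    · have hu' := (hmem u).2 (.inl hu)
      have huIn : u ∉ In := fun hx => by
        have h1 := hs.root u hx
        have h2 := h.inv.nodup
        rw [h.seen, List.nodup_append'] at h2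
        exact h2.2.2 hu (.tail _ h1)
      rw [hb.cut_old u hu']
      exact hb.cert_old u _ huIn (h.cert_new u hu)
  · obtain ⟨K, hK1, hK2, hK3, hK4⟩ := h.cut
    by_cases hlow : s.seen.length ≤ b.low
    · refine ⟨T.toFinset ∪ K, ?_, fun x hx => ?_, fun x hx y hy => ?_, fun x hx hxK => ?_⟩
      · simp only [hlow, if_true]
        rw [Finset.card_union_of_disjoint, List.toFinset_card_of_nodup hTn, hK1, hb.size, add_comm]
        rw [Finset.disjoint_left]
        intro x hx hxK
        exact hdisj x (List.mem_toFinset.1 hx) ((hmem x).2 (.inl (hK2 x hxK)))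
      · rw [Finset.mem_union, List.mem_toFinset] at hx
        rw [List.mem_append]
        exact hx.imp_right (hK2 x)
      · rw [Finset.mem_union, List.mem_toFinset] at hx ⊢
        rcases hx with hx | hx
        · rcases (hmemb y).1 (hb.closed x hx y hy) with h1 | h1
          · exact .inl (.inl h1)
          · rcases (hmem y).1 h1 with h2 | h2 | h2
            · exact absurd (h.closed y h2 x hy.symm) (hdisj x hx)
            · exact .inr h2
            · have h3 := hb.low_lower x hx y h1 hy
              rw [h.disc_old y h2] at h3
              have := hs.disc y h2
              omega
        · exact (hK3 x hx y hy).imp_left .inr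
      · rw [Finset.mem_union, List.mem_toFinset, not_or] at hxK
        exact hK4 x ((List.mem_append.1 hx).resolve_left hxK.1) hxK.2
    · refine ⟨K, ?_, fun x hx => List.mem_append_right _ (hK2 x hx), hK3, fun x hx hxK => ?_⟩
      · simp only [hlow, if_false]; exact hK1
      · rcases List.mem_append.1 hx with hx | hx
        · obtain ⟨u, hu, p, hp, hup, -⟩ := hback (not_le.1 hlow)
          have hne : ∀ y ∈ T, y ≠ v := by
            rintro y hy rfl
            exact hdisj y hy ((hmem y).2 (.inr (.inl rfl)))
          exact hb.linked _ ⟨u, hu, (hs.reach p hp v hv).step_delete hvIn hup.symm (hne u hu)⟩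
            (fun c _ d hd hc hcd => hc.step_delete hvIn hcd (hne d hd)) x hx
        · exact hK4 x hx hxK
  · have h1 := h.time_le
    have h2 := hb.time_le
    simp
    omega

theorem DfsScan.finish {G : SimpleGraph V} {A : V → List V} {In : List V} {v : V} {s : Dfs V}
    {seg : List V} {a : DfsAcc V} {t : ℕ} (hA : IsAdjList G A)
    (h : DfsScan G A In v s (A v) a t seg) (hs : DfsInv G In s) (hv : v ∉ s.seen) :
    DfsPost G A In v s ⟨⟨a.state.seen, a.state.disc, Function.update a.state.cut v a.cut⟩, a.low,
      a.size, a.cut⟩ (t + 3) (seg ++ [v]) := by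
  have hmem : ∀ x, x ∈ a.state.seen ↔ x ∈ seg ∨ x = v ∨ x ∈ s.seen := by simp [h.seen]
  have hvseg : v ∉ seg := by
    intro hx
    have := h.inv.nodup
    rw [h.seen, List.nodup_append'] at this
    exact this.2.2 hx List.mem_cons_self
  have hsegs : ∀ x ∈ seg, x ∉ s.seen := by
    intro x hx hx'
    have := h.inv.nodup
    rw [h.seen, List.nodup_append'] at this
    exact this.2.2 hx (.tail _ hx')
  have hnb : ∀ y, G.Adj v y → y ∈ a.state.seen := fun y hy => h.scanned y (((hA v).2 y).2 hy)
  refine ⟨by simp [h.seen], ⟨h.inv.nodup, h.inv.root, h.inv.reach, h.inv.component, h.inv.disc⟩, by simp,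
    by simp [h.size], h.disc_old, fun p hp => ?_, fun u hu => ?_, fun u hu y hy => ?_, ?_, h.low_le,
    fun u hu p hp hup => ?_, ?_, h.cert_old, fun u hu => ?_, ?_⟩
  · dsimp only
    rw [Function.update_of_ne (by rintro rfl; exact hv hp), h.cut_old p hp]
  · rcases List.mem_append.1 hu with hu | hu
    · exact (h.disc_new u hu).le
    · rw [List.mem_singleton.1 hu]; exact h.disc_self.ge
  · rcases List.mem_append.1 hu with hu | hu
    · exact h.closed u hu y hy
    · rw [List.mem_singleton.1 hu] at hy; exact hnb y hy
  · convert h.linked using 1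
    ext x
    simp [or_comm]
  · rcases List.mem_append.1 hu with hu | hu
    · exact h.low_lower u hu p hp hup
    · rw [List.mem_singleton.1 hu] at hup
      exact h.low_lower_self p (((hA v).2 p).2 hup) hp
  · refine h.low_attained.imp_right ?_
    rintro ⟨u, hu, h'⟩
    exact ⟨u, by simp at hu ⊢; tauto, h'⟩
  · rcases List.mem_append.1 hu with hu | hu
    · have huv : u ≠ v := fun huv => hvseg (huv ▸ hu)
      dsimp only
      rw [Function.update_of_ne huv]
      exact h.cert_new u hu
    · rw [List.mem_singleton.1 hu]
      dsimp only
      rw [Function.update_self]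
      obtain ⟨K, hK1, hK2, hK3, hK4⟩ := h.cut
      refine ⟨(hmem v).2 (.inr (.inl rfl)), hnb, K, hK1, fun hx => hvseg (hK2 v hx),
        fun x hx => ⟨(hmem x).2 (.inl (hK2 x hx)), fun hx' => ?_⟩, hK3, fun x hx hxK hxv => ?_⟩
      · exact hsegs x (hK2 x hx) (hs.root x hx')
      · rcases (hmem x).1 hx with h1 | h1 | h1
        · exact hK4 x h1 hxK
        · exact absurd h1 hxv
        · exact hs.reach x h1 v hv
  · have := h.time_le
    simp
    omega

/-- The search from a new neighbour `v` of a vertex `p` that has been seen.  The fuel suffices, since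
every recursive call sees one more vertex. -/
theorem dfs_spec [Fintype V] {G : SimpleGraph V} {A : V → List V} {In : List V}
    (hA : IsAdjList G A) :
    ∀ (t : ℕ) (v p : V) (s : Dfs V), DfsInv G In s → v ∉ s.seen → p ∈ s.seen → G.Adj p v →
      Fintype.card V ≤ s.seen.length + t →
      (dfs A t v s).Silent fun r time => ∃ T, DfsPost G A In v s r time T := by
  intro t
  induction t with
  | zero =>
    intro v p s hs hv _ _ ht
    have := List.Nodup.length_le_card (l := v :: s.seen) (by simp [hv, hs.nodup])
    rw [List.length_cons] at this
    omega
  | succ t ih =>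
    intro v p s hs hv hp hpv ht
    rw [dfs]
    refine Run.silent_op_bind (Run.silent_op_bind ?_)
    refine (Run.silent_foldlM (fun pre a time => ∃ seg, DfsScan G A In v s pre a time seg)
      ⟨[], DfsScan.start hs hv hp hpv⟩ ?_).bind ?_
    · rintro pre w suf a time hl ⟨seg, h⟩
      have hvw : G.Adj v w := ((hA v).2 w).1 (by simp [hl])
      refine Run.silent_op_bind ?_
      by_cases hw : w ∈ a.state.seen
      · simp only [hw, decide_true, if_true]
        exact Run.silent_op ⟨seg, h.skip hv hvw hw⟩
      · simp only [hw, decide_false, Bool.false_eq_true, if_false]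
        refine (ih w v a.state h.inv hw (by simp [h.seen]) hvw ?_).bind ?_
        · rw [h.seen, List.length_append, List.length_cons]; omega
        · rintro b time' ⟨T, hb⟩
          refine Run.silent_op ⟨T ++ seg, ?_⟩
          have := h.child hs hv hvw hb
          rwa [show time + (1 + (time' + 1)) = time + time' + 2 by omega]
    · rintro a time ⟨seg, h⟩
      refine Run.silent_op ⟨seg ++ [v], ?_⟩
      have := h.finish hA hs hv
      rwa [show 1 + (1 + (time + 1)) = time + 3 by omega]

/-- Invariants of the search of the whole component of `In`: `T` lists the vertices outside `In`
seen so far. -/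
structure DfsAllInv (G : SimpleGraph V) (A : V → List V) (In : List V) (s : Dfs V) (time : ℕ)
    (T : List V) : Prop where
  seen : s.seen = T ++ In
  inv : DfsInv G In s
  closed : ∀ u ∈ T, ∀ y, G.Adj u y → y ∈ s.seen
  cert : ∀ u ∈ T, CutCert G In s.seen u (s.cut u)
  time_le : time ≤ weight A T

/-- The search finds the component of `In`, and the numbers `cut u` recognise the mandatory vertices:
without `u`, the component of `In` has `cut u + 1` vertices fewer. -/
theorem dfsAll_spec [Fintype V] {G : SimpleGraph V} {A : V → List V} {k : ℕ} {In : List V}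
    (hA : IsAdjList G A) (hIn : IsRoot G k In) :
    (dfsAll A (Fintype.card V) In).Silent fun s t => s.seen.Nodup ∧
      (∀ w, w ∈ s.seen ↔ Reach G In w) ∧
      (∀ u, Reach G In u → u ∉ In → (s.seen.length ≤ k + s.cut u ↔ Mandatory G In k u)) ∧
      t ≤ weight A s.seen + 2 * s.seen.length := by
  have hpos : 0 < In.length := List.length_pos_iff.2 hIn.ne_nil
  unfold dfsAll
  refine Run.silent_charge_bind ?_
  refine (Run.silent_foldlM (fun pre s time => (∀ v ∈ pre, ∀ y, G.Adj v y → y ∈ s.seen) ∧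
    ∃ T time', DfsAllInv G A In s time' T ∧ time ≤ weight A pre + time') ?_ ?_).bind ?_
  · refine ⟨by simp, [], 0, ⟨rfl, ⟨hIn.nodup, fun _ => id, fun _ h _ _ => .base h,
      fun _ h => .base h, fun _ _ => hpos⟩, by simp, by simp, by simp⟩, by simp⟩
  · rintro pre v suf s time hl ⟨hpre, T, time', hT, htime⟩
    have hvIn : v ∈ In := by simp [hl]
    refine Run.silent_op_bind ?_
    refine (Run.silent_foldlM (fun done s' time'' => (∀ x ∈ s.seen, x ∈ s'.seen) ∧
      (∀ y ∈ done, y ∈ s'.seen) ∧ ∃ T t, DfsAllInv G A In s' t T ∧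
        time + time'' ≤ weight A pre + t + 2 * done.length)
      ⟨fun _ => id, by simp, T, time', hT, by simpa using htime⟩ ?_).mono ?_
    · rintro done w suf' s' t'' hl' ⟨h1, h2, T, t, h3, h4⟩
      have hvw : G.Adj v w := ((hA v).2 w).1 (by simp [hl'])
      have hmem : ∀ x, x ∈ s'.seen ↔ x ∈ T ∨ x ∈ In := by simp [h3.seen]
      refine Run.silent_op_bind ?_
      by_cases hw : w ∈ s'.seen
      · simp only [hw, decide_true, if_true]
        refine Run.silent_pure ⟨h1, fun y hy => ?_, T, t, h3, by simp; omega⟩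
        rcases List.mem_append.1 hy with hy | hy
        · exact h2 y hy
        · rwa [List.mem_singleton.1 hy]
      · simp only [hw, decide_false, Bool.false_eq_true, if_false]
        refine (dfs_spec hA _ w v s' h3.inv hw ((hmem v).2 (.inr hvIn)) hvw (by omega)).bind ?_
        rintro b tb ⟨S, hb⟩
        have hbs : ∀ x, x ∈ b.state.seen ↔ x ∈ S ∨ x ∈ s'.seen := by simp [hb.seen]
        refine Run.silent_op ⟨fun x hx => (hbs x).2 (.inr (h1 x hx)), fun y hy => ?_, S ++ T, tb + t,
          ⟨by rw [hb.seen, h3.seen, List.append_assoc], hb.inv, fun u hu y hy => ?_,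
            fun u hu => ?_, ?_⟩, by simp; omega⟩
        · rcases List.mem_append.1 hy with hy | hy
          · exact (hbs y).2 (.inr (h2 y hy))
          · rw [List.mem_singleton.1 hy]; exact (hbs w).2 (.inl hb.mem)
        · rcases List.mem_append.1 hu with hu | hu
          · exact hb.closed u hu y hy
          · exact (hbs y).2 (.inr (h3.closed u hu y hy))
        · rcases List.mem_append.1 hu with hu | hu
          · exact hb.cert_new u hu
          · have huIn : u ∉ In := by
              have h5 := h3.inv.nodup
              rw [h3.seen, List.nodup_append'] at h5
              exact fun hx => h5.2.2 hu hx
            rw [hb.cut_old u ((hmem u).2 (.inl hu))]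
            exact hb.cert_old u _ huIn (h3.cert u hu)
        · have := h3.time_le
          have := hb.time_le
          simp
          omega
    · rintro s' t'' ⟨h1, h2, T, t, h3, h4⟩
      refine ⟨fun u hu y hy => ?_, T, t, h3, by simp; omega⟩
      rcases List.mem_append.1 hu with hu | hu
      · exact h1 y (hpre u hu y hy)
      · rw [List.mem_singleton.1 hu] at hy
        exact h2 y (((hA v).2 y).2 hy)
  · rintro s time ⟨hpre, T, time', hT, htime⟩
    have hmem : ∀ x, x ∈ s.seen ↔ x ∈ T ∨ x ∈ In := by simp [hT.seen]
    have hreach : ∀ w, w ∈ s.seen ↔ Reach G In w := by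
      refine fun w => ⟨hT.inv.component w, fun hw => ?_⟩
      · refine hw.closed (p := (· ∈ s.seen)) (fun x hx => (hmem x).2 (.inr hx)) fun a b ha hab => ?_
        rcases (hmem a).1 ha with h | h
        · exact hT.closed a h b hab
        · exact hpre a h b hab
    refine Run.silent_charge_bind (Run.silent_pure ⟨hT.inv.nodup, hreach, fun u hu huIn => ?_, ?_⟩)
    · have huT : u ∈ T := ((hmem u).1 ((hreach u).2 hu)).resolve_right huIn
      obtain ⟨-, -, K, hK1, hK2, hK3, hK4, hK5⟩ := hT.cert u huT
      have hcomp : component (G.deleteIncidenceSet u) In = s.seen.toFinset \ insert u K := by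
        ext w
        rw [mem_component, Finset.mem_sdiff, List.mem_toFinset, Finset.mem_insert, not_or]
        refine ⟨fun hw => ⟨(hreach w).2 hw.delete_le, hw.delete_ne huIn, ?_⟩, fun hw => ?_⟩
        · refine hw.closed (p := (· ∉ K)) (fun x hx hxK => (hK3 x hxK).2 hx) fun a b ha hab hb => ?_
          rw [SimpleGraph.deleteIncidenceSet_adj] at hab
          exact (hK4 b hb a hab.1.symm).elim ha hab.2.1
        · exact hK5 w hw.1 hw.2.2 hw.2.1
      have hsub : insert u K ⊆ s.seen.toFinset := by
        intro x hx
        rw [List.mem_toFinset]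
        rcases Finset.mem_insert.1 hx with rfl | hx
        · exact (hreach x).2 hu
        · exact (hK3 x hx).1
      have hle := Finset.card_le_card hsub
      rw [Mandatory, hcomp, Finset.card_sdiff_of_subset hsub]
      rw [Finset.card_insert_of_notMem hK2, hK1, List.toFinset_card_of_nodup hT.inv.nodup] at *
      omega
    · have h1 := hT.time_le
      simp only [hT.seen, weight_append, List.length_append]
      omega

end DepthFirst

/-! ### Absorbing mandatory vertices -/

section Absorb

variable {V : Type} [Fintype V]

/-- Invariants of the loop that moves mandatory vertices into `In₀`. -/
structure AbsorbInv (G : SimpleGraph V) (In₀ : List V) (k : ℕ) (s : Absorb V) : Prop where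
  root : IsRoot G k s.In
  sub : ∀ x ∈ In₀, x ∈ s.In
  sols : ∀ S, Solution G k In₀ S → Solution G k s.In S
  todo : ∀ x ∈ s.todo, x ∈ s.In
  cand : ∀ w, s.cand = some w → Bdry G s.In w ∧ ¬ Mandatory G In₀ k w

variable [DecidableEq V]

/-- Here `v` is the vertex whose adjacency list is scanned, and `hcut` says that the test of the
algorithm recognises the mandatory vertices.  Whether a vertex is mandatory does not change while
`In` grows from `In₀`. -/
theorem absorbScan_spec {G : SimpleGraph V} {In₀ : List V} {k c : ℕ} {cut : V → ℕ}
    (hne : In₀ ≠ [])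
    (hcut : ∀ u, Reach G In₀ u → u ∉ In₀ → (c ≤ k + cut u ↔ Mandatory G In₀ k u)) {v : V} :
    ∀ (L : List V) (s : Absorb V), AbsorbInv G In₀ k s → v ∈ s.In → (∀ w ∈ L, G.Adj v w) →
      (absorbScan k c cut L s).Silent fun s' t => AbsorbInv G In₀ k s' ∧ (∀ x ∈ s.In, x ∈ s'.In) ∧
        (∀ x ∈ s.todo, x ∈ s'.todo) ∧ (∀ x ∈ s'.In, x ∈ s.In ∨ x ∈ s'.todo) ∧
        (s.cand ≠ none → s'.cand ≠ none) ∧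
        (s'.In.length ≠ k → ∀ y ∈ L, y ∈ s'.In ∨ s'.cand ≠ none) ∧
        s'.In.length + s.todo.length = s.In.length + s'.todo.length ∧ t ≤ 4 * L.length := by
  intro L
  induction L with
  | nil =>
    intro s hs hv _
    exact Run.silent_pure ⟨hs, fun _ => id, fun _ => id, fun _ => .inl, id, by simp, rfl, by simp⟩
  | cons w ws ih =>
    intro s hs hv hL
    rw [List.forall_mem_cons] at hL
    rw [absorbScan]
    refine Run.silent_op_bind ?_
    by_cases hk : s.In.length = k
    · simp only [hk, decide_true, if_true]
      exact Run.silent_pure ⟨hs, fun _ => id, fun _ => id, fun _ => .inl, id, by tauto,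
        by rw [hk], by simp; omega⟩
    · simp only [hk, decide_false, Bool.false_eq_true, if_false]
      refine Run.silent_op_bind ?_
      by_cases hw : w ∈ s.In
      · simp only [hw, decide_true, if_true]
        refine (ih s hs hv hL.2).mono ?_
        rintro s' t ⟨h1, h2, h3, h4, h5, h6, h7, h8⟩
        refine ⟨h1, h2, h3, h4, h5, fun h => ?_, h7, by simp; omega⟩
        rw [List.forall_mem_cons]
        exact ⟨.inl (h2 w hw), h6 h⟩
      · simp only [hw, decide_false, Bool.false_eq_true, if_false]
        refine Run.silent_op_bind ?_
        have hwb : Bdry G s.In w := ⟨hw, v, hv, hL.1⟩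
        have hw₀ : w ∉ In₀ := fun h => hw (hs.sub w h)
        have hwr : Reach G In₀ w := (reach_iff_of_subset hs.root.linked hne hs.sub).1 hwb.reach
        have hlt : s.In.length < k := lt_of_le_of_ne hs.root.length_le hk
        by_cases hc : c ≤ k + cut w
        · simp only [hc, decide_true, if_true]
          have hm := (hcut w hwr hw₀).1 hc
          refine Run.silent_op_bind ?_
          have hs' : AbsorbInv G In₀ k ⟨w :: s.In, w :: s.todo, s.cand⟩ := by
            refine ⟨hs.root.cons hwb hlt, fun x hx => .tail _ (hs.sub x hx),
              fun S hS => solution_cons.2 ⟨hs.sols S hS, hm.mem hne hw₀ hS⟩, fun x hx => ?_,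
              fun u hu => ?_⟩
            · rcases List.mem_cons.1 hx with rfl | hx
              · exact List.mem_cons_self
              · exact .tail _ (hs.todo x hx)
            · obtain ⟨⟨h1, b, hb, hbu⟩, h2⟩ := hs.cand u hu
              refine ⟨⟨fun h => ?_, b, .tail _ hb, hbu⟩, h2⟩
              rcases List.mem_cons.1 h with rfl | h
              · exact h2 hm
              · exact h1 h
          refine (ih _ hs' (.tail _ hv) hL.2).mono ?_
          rintro s' t ⟨h1, h2, h3, h4, h5, h6, h7, h8⟩
          simp only [List.mem_cons, forall_eq_or_imp, List.length_cons] at h2 h3 h4 h7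
          refine ⟨h1, h2.2, h3.2, fun x hx => ?_, h5, fun h => ?_, by omega, by simp; omega⟩
          · rcases h4 x hx with (rfl | h) | h
            · exact .inr h3.1
            · exact .inl h
            · exact .inr h
          · rw [List.forall_mem_cons]
            exact ⟨.inl h2.1, h6 h⟩
        · simp only [hc, decide_false, Bool.false_eq_true, if_false]
          refine Run.silent_op_bind ?_
          have hs' : AbsorbInv G In₀ k ⟨s.In, s.todo, some w⟩ := by
            refine ⟨hs.root, hs.sub, hs.sols, hs.todo, fun u hu => ?_⟩
            rw [← Option.some.inj hu]
            exact ⟨hwb, fun h => hc ((hcut w hwr hw₀).2 h)⟩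
          refine (ih _ hs' hv hL.2).mono ?_
          rintro s' t ⟨h1, h2, h3, h4, h5, h6, h7, h8⟩
          have h9 := h5 (by simp)
          exact ⟨h1, h2, h3, h4, fun _ => h9, fun h y _ => .inr h9, h7, by simp; omega⟩

/-- When the loop ends early, every vertex of `N(In)` has been met and rejected.  The time bound
says that `1 + 4 d` units are spent on every vertex taken from the list `todo`. -/
theorem absorbLoop_spec {G : SimpleGraph V} {A : V → List V} {In₀ : List V} {k c d : ℕ}
    {cut : V → ℕ} (hA : IsAdjList G A) (hne : In₀ ≠ [])
    (hcut : ∀ u, Reach G In₀ u → u ∉ In₀ → (c ≤ k + cut u ↔ Mandatory G In₀ k u)) :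
    ∀ (t : ℕ) (s : Absorb V), AbsorbInv G In₀ k s →
      (s.In.length ≠ k → ∀ x ∈ s.In, x ∉ s.todo → ∀ y, G.Adj x y → y ∈ s.In ∨ s.cand ≠ none) →
      s.In.length + t = s.todo.length + Fintype.card V →
      (absorbLoop A k c cut t s).Silent fun s' time => AbsorbInv G In₀ k s' ∧
        (s'.In.length ≠ k → ∀ x ∈ s'.In, ∀ y, G.Adj x y → y ∈ s'.In ∨ s'.cand ≠ none) ∧
        ((∀ v, Reach G In₀ v → (A v).length ≤ d) →
          time + (s.In.length + s'.todo.length) * (1 + 4 * d) ≤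
            (s'.In.length + s.todo.length) * (1 + 4 * d) + 1) := by
  intro t
  induction t with
  | zero =>
    intro s hs hcl hlen
    have := hs.root.nodup.length_le_card
    have hnil : s.todo = [] := List.length_eq_zero_iff.1 (by omega)
    exact Run.silent_pure ⟨hs, fun h x hx => hcl h x hx (by simp [hnil]), fun _ => by omega⟩
  | succ t ih =>
    intro s hs hcl hlen
    rw [absorbLoop]
    refine Run.silent_op_bind ?_
    by_cases hk : s.In.length = k
    · simp only [hk, decide_true, if_true]
      exact Run.silent_pure ⟨hs, fun h => absurd hk h, fun _ => by rw [hk]; omega⟩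
    · simp only [hk, decide_false, Bool.false_eq_true, if_false]
      split
      · next hnil =>
        exact Run.silent_pure ⟨hs, fun h x hx => hcl h x hx (by simp [hnil]), fun _ => by omega⟩
      · next v q hq =>
        have hv : v ∈ s.In := hs.todo v (by simp [hq])
        have hs₁ : AbsorbInv G In₀ k ⟨s.In, q, s.cand⟩ :=
          ⟨hs.root, hs.sub, hs.sols, fun x hx => hs.todo x (by simp [hq, hx]), hs.cand⟩
        refine (absorbScan_spec hne hcut (A v) _ hs₁ hv fun w hw => ((hA v).2 w).1 hw).bind ?_
        rintro s' t' ⟨h1, h2, h3, h4, h5, h6, h7, h8⟩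
        dsimp only at h2 h3 h4 h5 h7
        have hq' : s.todo.length = q.length + 1 := by simp [hq]
        refine (ih s' h1 (fun hk' x hx hxq y hxy => ?_) (by omega)).mono ?_
        · rcases h4 x hx with h | h
          · rcases eq_or_ne x v with rfl | hxv
            · exact h6 hk' y (((hA x).2 y).2 hxy)
            · have hxq' : x ∉ q := fun h => hxq (h3 x h)
              exact (hcl hk x h (by simp [hq, hxv, hxq']) y hxy).imp (h2 y) h5
          · exact absurd h hxq
        · rintro s'' t'' ⟨h9, h10, h11⟩
          refine ⟨h9, h10, fun hd => ?_⟩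
          have h12 := h11 hd
          have h13 := hd v ((reach_iff_of_subset hs.root.linked hne hs.sub).1 (.base hv))
          have h14 := congrArg (· * (1 + 4 * d)) h7
          rw [hq]
          simp only [Nat.add_mul, List.length_cons] at h12 h14 ⊢
          omega

end Absorb

/-! ### The enumeration procedures -/

section Enumeration

variable {V : Type}

/-- The output and the time of `m` satisfy `R`. -/
def Run.Sat {α : Type} (m : Run V α) (R : List (List V) → ℕ → Prop) : Prop :=
  R m.out m.time

theorem Run.Sat.mono {α : Type} {m : Run V α} {R R' : List (List V) → ℕ → Prop} (h : m.Sat R)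
    (hR : ∀ o t, R o t → R' o t) : m.Sat R' :=
  hR _ _ h

theorem Run.Sat.bind {α : Type} {m : Run V Unit} {f : Unit → Run V α}
    {R R' : List (List V) → ℕ → Prop} (h : m.Sat R)
    (hf : ∀ o t, R o t → (f ()).Sat fun o' t' => R' (o ++ o') (t + t')) : (m >>= f).Sat R' :=
  hf _ _ h

theorem Run.Silent.sat_bind {α β : Type} {m : Run V α} {f : α → Run V β} {Q : α → ℕ → Prop}
    {R : List (List V) → ℕ → Prop} (h : m.Silent Q)
    (hf : ∀ a t, Q a t → (f a).Sat fun o t' => R o (t + t')) : (m >>= f).Sat R := by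
  have := hf _ _ h.2
  unfold Run.Sat at this ⊢
  simpa [h.1] using this

theorem Run.sat_op_bind {α β : Type} {a : α} {f : α → Run V β} {R : List (List V) → ℕ → Prop}
    (h : (f a).Sat fun o t => R o (1 + t)) : (op a >>= f).Sat R :=
  h

theorem Run.sat_charge_bind {β : Type} {c : ℕ} {f : Unit → Run V β}
    {R : List (List V) → ℕ → Prop} (h : (f ()).Sat fun o t => R o (c + t)) :
    (charge c >>= f).Sat R :=
  h

theorem isRoot_singleton {G : SimpleGraph V} {k : ℕ} (hk : 2 ≤ k) (v : V) : IsRoot G k [v] :=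
  ⟨by simp, by simp, by simpa using linked_singleton G v, by simp; omega⟩

variable [DecidableEq V]

theorem enumerates_nil {G : SimpleGraph V} {k : ℕ} {In : List V}
    (h : ∀ S, ¬ Solution G k In S) : Enumerates [] G k In :=
  ⟨by simp, fun S => by simp [h S]⟩

theorem Enumerates.congr {G : SimpleGraph V} {k : ℕ} {In In' : List V} {o : List (List V)}
    (h : Enumerates o G k In) (hI : ∀ S, Solution G k In S ↔ Solution G k In' S) :
    Enumerates o G k In' :=
  ⟨h.1, fun S => (h.2 S).trans (hI S)⟩

theorem enumerates_singleton {G : SimpleGraph V} {k : ℕ} {In : List V} (h : IsRoot G k In)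
    (hk : In.length = k) : Enumerates [In] G k In := by
  refine ⟨by simp, fun S => ?_⟩
  simp only [List.map_cons, List.map_nil, List.mem_singleton]
  have hcard := List.toFinset_card_of_nodup h.nodup
  constructor
  · rintro rfl
    exact ⟨by omega, fun x => by simp, by simpa using h.linked⟩
  · intro hS
    refine (Finset.eq_of_subset_of_card_le (fun x hx => hS.2.1 x (by simpa using hx)) ?_).symm
    rw [hS.1]
    omega

/-- Branching on a vertex `z` outside `In`: the solutions that contain `z`, and those that
do not. -/
theorem Enumerates.branch {G : SimpleGraph V} {k : ℕ} {In : List V} {z : V}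
    {o o' : List (List V)} (hne : In ≠ []) (hz : z ∉ In) (h : Enumerates o G k (z :: In))
    (h' : Enumerates o' (G.deleteIncidenceSet z) k In) : Enumerates (o ++ o') G k In := by
  refine ⟨?_, fun S => ?_⟩
  · rw [List.map_append, List.nodup_append']
    refine ⟨h.1, h'.1, fun S hS hS' => ?_⟩
    exact ((solution_deleteIncidenceSet hne hz).1 ((h'.2 S).1 hS')).2
      (solution_cons.1 ((h.2 S).1 hS)).2
  · rw [List.map_append, List.mem_append, h.2, h'.2, solution_cons,
      solution_deleteIncidenceSet hne hz]
    tauto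

theorem Enumerates.ne_nil {G : SimpleGraph V} {k : ℕ} {In : List V} {o : List (List V)}
    (h : Enumerates o G k In) {S : Finset V} (hS : Solution G k In S) : o ≠ [] := by
  rintro rfl
  simpa using (h.2 S).2 hS

variable [Fintype V]

/-- With `c = 40 k min(k, D)` each call costs at most `c` besides its recursive calls, and the bound
`time + c ≤ 2 c (number of outputs)` adds up over the two branches. -/
theorem linEnumV_spec {k D : ℕ} (hk : 2 ≤ k) (hD1 : 1 ≤ D) :
    ∀ (t : ℕ) (G : SimpleGraph V) (A : V → List V) (In : List V), IsAdjList G A → IsRoot G k In →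
      (∀ v, (A v).length ≤ D) → (component G In).card + 1 ≤ In.length + t →
      (linEnumV (Fintype.card V) k t A In).Sat fun o time => Enumerates o G k In ∧
        (k ≤ (component G In).card → (component G In).card ≤ 2 * k →
          time + 40 * (k * min k D) ≤ 80 * (k * min k D) * o.length) := by
  intro t
  induction t with
  | zero =>
    intro G A In _ hIn _ ht
    have := length_le_component (G := G) hIn.nodup
    omega
  | succ t ih =>
    intro G A In hA hIn hD ht
    have hm : 1 ≤ min k D := by omega
    have hkm : k ≤ k * min k D := Nat.le_mul_of_pos_right k hm
    rw [linEnumV]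
    refine Run.sat_op_bind ?_
    by_cases hlen : In.length = k
    · simp only [hlen, decide_true, if_true]
      refine ⟨enumerates_singleton hIn hlen, fun _ _ => ?_⟩
      simp only [Run.time_emit, Run.out_emit, List.length_singleton]
      omega
    · simp only [hlen, decide_false, Bool.false_eq_true, if_false]
      refine (dfsAll_spec hA hIn).sat_bind ?_
      rintro s ts ⟨hs1, hs2, hs3, hs4⟩
      refine Run.sat_charge_bind ?_
      refine (absorbLoop_spec (d := 2 * min k D) hA hIn.ne_nil hs3 _ ⟨In, In, none⟩
        ⟨hIn, fun _ => id, fun _ => id, fun _ => id, by simp⟩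
        (fun _ x hx hx' => absurd hx hx') rfl).sat_bind ?_
      rintro r tr ⟨hr1, hr2, hr3⟩
      dsimp only at hr3
      have hsols : ∀ S, Solution G k r.In S ↔ Solution G k In S := fun S =>
        ⟨fun h => ⟨h.1, fun x hx => h.2.1 x (hr1.sub x hx), h.2.2⟩, hr1.sols S⟩
      have hcomp := component_eq_of_subset hr1.root.linked hIn.ne_nil hr1.sub
      have hrlen := hr1.root.length_le
      have hlenr : In.length ≤ r.In.length := length_le_of_nodup_subset hIn.nodup hr1.sub
      -- all adjacency lists of the component are short
      have hdeg : (component G In).card ≤ 2 * k → ∀ v, Reach G In v →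
          (A v).length ≤ 2 * min k D := by
        intro h2k v hv
        refine le_mul_min ?_ (by have := hD v; omega)
        rw [← List.toFinset_card_of_nodup (hA v).1]
        refine (Finset.card_le_card fun w hw => ?_).trans h2k
        exact mem_component.2 (hv.step (((hA v).2 w).1 (List.mem_toFinset.1 hw)))
      have hown : (component G In).card ≤ 2 * k →
          ts + In.length + tr + (r.In.length - In.length) ≤ 32 * (k * min k D) := by
        intro h2k
        have hd := hdeg h2k
        have hw : weight A s.seen ≤ 2 * k * (3 + 2 * (2 * min k D)) := by
          refine (List.sum_le_card_nsmul _ (3 + 2 * (2 * min k D)) fun x hx => ?_).trans ?_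
          · obtain ⟨a, ha, rfl⟩ := List.mem_map.1 hx
            have := hd a ((hs2 a).1 ha)
            omega
          · rw [List.length_map, smul_eq_mul]
            refine Nat.mul_le_mul_right _ (le_trans ?_ h2k)
            rw [← List.toFinset_card_of_nodup hs1]
            exact Finset.card_le_card fun w hw => mem_component.2 ((hs2 w).1 (by simpa using hw))
        have hsl : s.seen.length ≤ 2 * k := by
          refine le_trans ?_ h2k
          rw [← List.toFinset_card_of_nodup hs1]
          exact Finset.card_le_card fun w hw => mem_component.2 ((hs2 w).1 (by simpa using hw))
        have h1 := hr3 hd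
        have h2 : r.In.length * (1 + 4 * (2 * min k D)) ≤ k * (1 + 4 * (2 * min k D)) :=
          Nat.mul_le_mul_right _ hrlen
        have h3 : 2 * k * (3 + 2 * (2 * min k D)) = 6 * k + 8 * (k * min k D) := by ring
        have h4 : k * (1 + 4 * (2 * min k D)) = k + 8 * (k * min k D) := by ring
        simp only [Nat.add_mul] at h1
        omega
      refine Run.sat_charge_bind (Run.sat_op_bind ?_)
      by_cases hrk : r.In.length = k
      · simp only [hrk, decide_true, if_true]
        refine ⟨(enumerates_singleton hr1.root hrk).congr hsols, fun _ h2k => ?_⟩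
        have := hown h2k
        simp only [Run.time_emit, Run.out_emit, List.length_singleton]
        omega
      · simp only [hrk, decide_false, Bool.false_eq_true, if_false]
        have hrlt : r.In.length < k := lt_of_le_of_ne hrlen hrk
        split
        · next hnone =>
          have hno : ∀ S, ¬ Solution G k In S := by
            intro S hS
            obtain ⟨w, -, hw, a, ha, haw⟩ := (hr1.sols S hS).exists_bdry hr1.root.ne_nil hrlt
            rcases hr2 hrk a ha w haw with h | h
            · exact hw h
            · exact h hnone
          refine ⟨enumerates_nil hno, fun hkc _ => ?_⟩
          obtain ⟨S, hS⟩ := exists_solution hIn.nodup hIn.ne_nil hIn.linked hIn.length_le hkc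
          exact absurd hS (hno S)
        · next v hv =>
          obtain ⟨hvb, hvm⟩ := hr1.cand v hv
          have hvm' := mt (mandatory_iff_of_subset hr1.root.linked hIn.ne_nil hr1.sub hvb.1).1 hvm
          have hroot := hr1.root.cons hvb hrlt
          have hcons : component G (v :: r.In) = component G r.In :=
            component_eq_of_subset hroot.linked hr1.root.ne_nil (by simp +contextual)
          have hdel := component_delete_card_lt hvb.1 hvb.reach
          refine (ih G A (v :: r.In) hA hroot hD (by
            rw [hcons, hcomp, List.length_cons]; omega)).bind ?_
          rintro o₁ t₁ ⟨ho₁, ht₁⟩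
          refine (deleteVertex_spec hA v).sat_bind ?_
          rintro B tB ⟨hB, rfl⟩
          refine (ih _ B r.In hB (hr1.root.delete hvb.1) (fun u =>
            (hA.length_le hB (SimpleGraph.deleteIncidenceSet_le G v) u).trans (hD u)) (by
              rw [hcomp] at hdel; omega)).bind ?_
          rintro o₂ t₂ ⟨ho₂, ht₂⟩
          refine ⟨?_, fun hkc h2k => ?_⟩
          · rw [Run.out_charge, List.append_nil]
            exact (ho₁.branch hr1.root.ne_nil hvb.1 ho₂).congr hsols
          · rw [Mandatory, not_lt] at hvm'
            rw [hcomp] at hdel hcons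
            have h1 := ht₁ (by rwa [hcons]) (by rwa [hcons])
            have h2 := ht₂ hvm' (by omega)
            have h3 := hown h2k
            have h4 := hdeg h2k v (by rw [← mem_component, ← hcomp, mem_component]; exact hvb.reach)
            have h5 : min k D ≤ k * min k D := Nat.le_mul_of_pos_left _ (by omega)
            rw [Run.time_charge, Run.out_charge, List.append_nil, List.length_append, Nat.mul_add]
            omega

/-- The same accounting as for `linEnumV`, with an additional `2 (k - |In|)` per output, from which
the deletions of vertices of large degree are paid. -/
theorem enumV_spec {k D : ℕ} (hk : 2 ≤ k) (hD1 : 1 ≤ D) :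
    ∀ (t : ℕ) (G : SimpleGraph V) (A : V → List V) (In : List V), IsAdjList G A → IsRoot G k In →
      In.length ≤ k - 1 →
      (∀ v, (A v).length ≤ D) → (component G In).card + 1 ≤ In.length + t →
      (enumV (Fintype.card V) k t A In).Sat fun o time => Enumerates o G k In ∧
        (k ≤ (component G In).card →
          time + 100 * (k * min k D) ≤
            (200 * (k * min k D) + 2 * (k - In.length)) * o.length) := by
  intro t
  induction t with
  | zero =>
    intro G A In _ hIn _ _ ht
    have := length_le_component (G := G) hIn.nodup
    omega
  | succ t ih =>
    intro G A In hA hIn hInk hD ht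
    have hm : 1 ≤ min k D := by omega
    have hkm : k ≤ k * min k D := Nat.le_mul_of_pos_right k hm
    -- the bound for a leaf of the recursion, in terms of the time spent in it
    have hleaf : ∀ (o : List (List V)) (time : ℕ), Enumerates o G k In →
        (k ≤ (component G In).card → o ≠ [] →
          time ≤ 20 * (k * min k D) + 80 * (k * min k D) * o.length) →
        (k ≤ (component G In).card → time + 100 * (k * min k D) ≤
            (200 * (k * min k D) + 2 * (k - In.length)) * o.length) := by
      intro o time ho htime hkc
      obtain ⟨S, hS⟩ := exists_solution hIn.nodup hIn.ne_nil hIn.linked hIn.length_le hkc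
      have h1 := htime hkc (ho.ne_nil hS)
      have h2 : 1 ≤ o.length := List.length_pos_iff.2 (ho.ne_nil hS)
      have h3 : k * min k D ≤ k * min k D * o.length := Nat.le_mul_of_pos_right _ h2
      rw [Nat.add_mul, Nat.mul_assoc]
      rw [Nat.mul_assoc] at h1
      omega
    rw [enumV]
    refine Run.sat_op_bind ?_
    by_cases hlen : In.length = k - 1
    · simp only [hlen, decide_true, if_true]
      obtain ⟨h1, h2⟩ := outputAll_spec (k := k) hA hIn (by omega) hD hD1
      rw [hlen] at hleaf
      refine ⟨h1, hleaf _ _ h1 fun _ hne => ?_⟩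
      have := h2 hne
      rw [Nat.mul_assoc] at this ⊢
      omega
    · simp only [hlen, decide_false, Bool.false_eq_true, if_false]
      refine (findTwo_bdry hA hIn.length_le hk hD).sat_bind ?_
      rintro f tf ⟨hf, htf⟩
      have hkmul : k * (1 + 7 * min k D) = k + 7 * (k * min k D) := by ring
      have hkmul' : k * (10 * min k D) = 10 * (k * min k D) := by ring
      rw [hkmul] at htf
      have hInpos : 0 < In.length := List.length_pos_iff.2 hIn.ne_nil
      refine (chain_spec hA hk hD hD1 k In f hIn (by omega) (by omega) hf).sat_bind ?_
      rintro ⟨In', f'⟩ tc ⟨hr1, hr2, hr3, hr4, hr5, hr6⟩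
      dsimp only at hr1 hr2 hr3 hr4 hr5 hr6 ⊢
      rw [hkmul'] at hr6
      have hsols : ∀ S, Solution G k In' S ↔ Solution G k In S := fun S =>
        ⟨fun h => ⟨h.1, fun x hx => h.2.1 x (hr2 x hx), h.2.2⟩, hr4 S⟩
      have hcomp := component_eq_of_subset hr1.linked hIn.ne_nil hr2
      have hlen' : In.length ≤ In'.length := length_le_of_nodup_subset hIn.nodup hr2
      refine Run.sat_charge_bind (Run.sat_op_bind ?_)
      by_cases hrk : In'.length = k - 1
      · simp only [hrk, decide_true, if_true]
        obtain ⟨h1, h2⟩ := outputAll_spec (k := k) hA hr1 (by omega) hD hD1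
        refine ⟨h1.congr hsols, hleaf _ _ (h1.congr hsols) fun _ hne => ?_⟩
        have := h2 hne
        rw [Nat.mul_assoc] at this ⊢
        omega
      · simp only [hrk, decide_false, Bool.false_eq_true, if_false]
        obtain ⟨hf1, hf2⟩ := hr5 hrk
        split
        · next x y l =>
          have hx := hf1.mem x (by simp)
          have hy := hf1.mem y (by simp)
          have hxy : x ≠ y := by
            rintro rfl
            simpa using hf1.nodup
          refine (pickNonMandatory_spec hA hr1 hx.1 hy.1 hk hD hD1).sat_bind ?_
          rintro c tp ⟨hc1, hc2, htp⟩
          cases c with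
          | none =>
            obtain ⟨mx, my⟩ := hc2 rfl
            have h2k := component_card_le_of_mandatory hx hy hxy mx my
            have hcc : (component G In').card ≤ Fintype.card V := Finset.card_le_univ _
            refine (linEnumV_spec hk hD1 _ G A In' hA hr1 hD (by omega)).mono ?_
            rintro o tl ⟨ho, htl⟩
            refine ⟨ho.congr hsols, hleaf _ _ (ho.congr hsols) fun hkc hne => ?_⟩
            have := htl (by rwa [hcomp]) h2k
            omega
          | some z =>
            obtain ⟨hz, hzm⟩ := hc1 z rfl
            have hzb : Bdry G In' z := by rcases hz with rfl | rfl <;> assumption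
            have hroot := hr1.cons hzb (by omega)
            have hcons : component G (z :: In') = component G In' :=
              component_eq_of_subset hroot.linked hr1.ne_nil (by simp +contextual)
            have hdel := component_delete_card_lt hzb.1 hzb.reach
            dsimp only
            refine (ih G A (z :: In') hA hroot (by rw [List.length_cons]; omega) hD (by
              rw [hcons, hcomp, List.length_cons]; omega)).bind ?_
            rintro o₁ t₁ ⟨ho₁, ht₁⟩
            refine (deleteVertex_spec hA z).sat_bind ?_
            rintro B tB ⟨hB, rfl⟩
            refine (ih _ B In' hB (hr1.delete hzb.1) hr3 (fun u =>
              (hA.length_le hB (SimpleGraph.deleteIncidenceSet_le G z) u).trans (hD u)) (by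
                rw [hcomp] at hdel; omega)).bind ?_
            rintro o₂ t₂ ⟨ho₂, ht₂⟩
            refine ⟨?_, fun hkc => ?_⟩
            · rw [Run.out_charge, List.append_nil]
              exact (ho₁.branch hr1.ne_nil hzb.1 ho₂).congr hsols
            · rw [Mandatory, not_lt] at hzm
              rw [hcomp] at hcons
              have h1 := ht₁ (by rwa [hcons])
              have h2 := ht₂ hzm
              -- the deletion of `z` is paid for by the solutions that contain `z`
              have hdeg : (A z).length ≤ k + o₁.length := by
                rw [← List.toFinset_card_of_nodup (hA z).1]
                refine (card_neighbors_le hroot.nodup hroot.linked (by rw [List.length_cons]; omega)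
                  List.mem_cons_self (A z).toFinset
                  (fun w hw => ((hA z).2 w).1 (List.mem_toFinset.1 hw))
                  (o₁.map List.toFinset).toFinset
                  fun S hS => List.mem_toFinset.2 ((ho₁.2 S).2 hS)).trans ?_
                have := (o₁.map List.toFinset).toFinset_card_le
                rw [List.length_map] at this
                omega
              have h3 : (k - (z :: In').length) * o₁.length + o₁.length ≤
                  (k - In.length) * o₁.length := by
                rw [← Nat.succ_mul]
                exact Nat.mul_le_mul_right _ (by rw [List.length_cons]; omega)
              have h4 : (k - In'.length) * o₂.length ≤ (k - In.length) * o₂.length :=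
                Nat.mul_le_mul_right _ (by omega)
              rw [Run.time_charge, Run.out_charge, List.append_nil, List.length_append, Nat.mul_add]
              simp only [Nat.add_mul, Nat.mul_assoc] at h1 h2 h3 h4 ⊢
              omega
        · next l hl =>
          have hnil : f' = [] := by
            match f', hf2, hl with
            | [], _, _ => rfl
            | [x], h, _ => simp at h
            | x :: y :: l, _, h => exact absurd rfl (h x y l)
          subst hnil
          have hno : ∀ S, ¬ Solution G k In S := by
            intro S hS
            obtain ⟨w, -, hw⟩ := (hr4 S hS).exists_bdry hr1.ne_nil (by omega)
            simpa using hf1.all (by simp) w hw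
          have := enumerates_nil hno
          refine ⟨this, hleaf _ _ this fun _ h => absurd rfl h⟩

theorem enumFrom_spec {G : SimpleGraph V} {A : V → List V} (hA : IsAdjList G A) {k D : ℕ}
    (hk : 2 ≤ k) (hD1 : 1 ≤ D) (hD : ∀ v, (A v).length ≤ D) (v : V) :
    Enumerates (enumFrom A k v).out G k [v] ∧ ((graphletsAt G k v).Nonempty →
      (enumFrom A k v).time ≤ 202 * ((graphletsAt G k v).ncard * k * min k D)) := by
  have hcc : (component G [v]).card ≤ Fintype.card V := Finset.card_le_univ _
  obtain ⟨h1, h2⟩ := enumV_spec hk hD1 (Fintype.card V) G A [v] hA (isRoot_singleton hk v)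
    (by simp; omega) hD (by simp; omega)
  change Enumerates (enumFrom A k v).out G k [v] at h1
  refine ⟨h1, fun ⟨S, hS⟩ => ?_⟩
  rw [mem_graphletsAt] at hS
  have hkc : k ≤ (component G [v]).card := by
    rw [← hS.1]
    exact Finset.card_le_card fun x hx => mem_component.2 (hS.reach (by simp) x hx)
  have hset : graphletsAt G k v =
      (((enumFrom A k v).out.map List.toFinset).toFinset : Set (Finset V)) := by
    ext S
    rw [mem_graphletsAt, Finset.mem_coe, List.mem_toFinset]
    exact (h1.2 S).symm
  have hcard : (graphletsAt G k v).ncard = (enumFrom A k v).out.length := by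
    rw [hset, Set.ncard_coe_finset, List.toFinset_card_of_nodup h1.1, List.length_map]
  have h3 := h2 hkc
  have hm : 1 ≤ min k D := by omega
  have hkm : k ≤ k * min k D := Nat.le_mul_of_pos_right k hm
  rw [hcard]
  calc (enumFrom A k v).time
      ≤ (200 * (k * min k D) + 2 * (k - [v].length)) * (enumFrom A k v).out.length := by
        refine le_trans ?_ h3
        exact Nat.le_add_right _ _
    _ ≤ 202 * (k * min k D) * (enumFrom A k v).out.length := Nat.mul_le_mul_right _ (by omega)
    _ = _ := by ring

end Enumeration

end Graphlet

open Graphlet in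
theorem mainTheorem4 :
    -- ENUM-V lists the `k`-graphlets that contain `v`, each exactly once
    (∀ (V : Type) [Fintype V] [DecidableEq V] (G : SimpleGraph V) (A : V → List V)
        (_ : IsAdjList G A) (k : ℕ) (_ : 2 ≤ k) (v : V),
      ((enumFrom A k v).out.map List.toFinset).Nodup ∧
      ∀ S : Finset V, S ∈ (enumFrom A k v).out.map List.toFinset ↔ S ∈ graphletsAt G k v) ∧
    -- in time `O(N k min (k, Δ))`
    (∃ C : ℕ, ∀ (V : Type) [Fintype V] [DecidableEq V] (G : SimpleGraph V)
        [DecidableRel G.Adj] (A : V → List V)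
        (_ : IsAdjList G A) (k : ℕ) (_ : 2 ≤ k) (v : V) (_ : (graphletsAt G k v).Nonempty),
      (enumFrom A k v).time ≤ C * ((graphletsAt G k v).ncard * k * min k G.maxDegree)) ∧
    -- hence in time `O(k)` per graphlet for graphs whose maximum degree is bounded by a constant
    (∀ D : ℕ, ∃ C : ℕ, ∀ (V : Type) [Fintype V] [DecidableEq V] (G : SimpleGraph V)
        [DecidableRel G.Adj] (_ : G.maxDegree ≤ D) (A : V → List V)
        (_ : IsAdjList G A) (k : ℕ) (_ : 2 ≤ k) (v : V) (_ : (graphletsAt G k v).Nonempty),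
      (enumFrom A k v).time ≤ C * (k * (graphletsAt G k v).ncard)) := by
  have htime : ∀ (V : Type) [Fintype V] [DecidableEq V] (G : SimpleGraph V)
      [DecidableRel G.Adj] (A : V → List V)
      (_ : IsAdjList G A) (k : ℕ) (_ : 2 ≤ k) (v : V) (_ : (graphletsAt G k v).Nonempty),
      (enumFrom A k v).time ≤ 202 * ((graphletsAt G k v).ncard * k * min k G.maxDegree) := by
    intro V _ _ G _ A hA k hk v hne
    obtain ⟨S, hS⟩ := hne
    obtain ⟨w, -, -, a, -, haw⟩ := (mem_graphletsAt.1 hS).exists_bdry (by simp) (by simp; omega)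
    have hpos : 1 ≤ G.maxDegree :=
      (Nat.one_le_iff_ne_zero.2 ((G.degree_pos_iff_exists_adj a).2 ⟨w, haw⟩).ne').trans
        (G.degree_le_maxDegree a)
    refine (enumFrom_spec hA hk hpos (fun u => ?_) v).2 ⟨S, hS⟩
    refine le_trans (le_of_eq ?_) (G.degree_le_maxDegree u)
    rw [← List.toFinset_card_of_nodup (hA u).1, ← G.card_neighborFinset_eq_degree]
    congr 1
    ext x
    simp [(hA u).2]
  refine ⟨?_, ⟨202, htime⟩, fun D => ⟨202 * D, ?_⟩⟩
  · intro V _ _ G A hA k hk v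
    have hcard : 1 ≤ Fintype.card V := Fintype.card_pos_iff.2 ⟨v⟩
    obtain ⟨h1, h2⟩ :=
      (enumFrom_spec hA hk hcard (fun u => (hA u).1.length_le_card) v).1
    exact ⟨h1, fun S => (h2 S).trans mem_graphletsAt.symm⟩
  · intro V _ _ G _ hD A hA k hk v hne
    refine (htime V G A hA k hk v hne).trans ?_
    calc 202 * ((graphletsAt G k v).ncard * k * min k G.maxDegree)
        ≤ 202 * ((graphletsAt G k v).ncard * k * D) :=
          Nat.mul_le_mul_left _ (Nat.mul_le_mul_left _ ((min_le_right _ _).trans hD))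
      _ = 202 * D * (k * (graphletsAt G k v).ncard) := by ring
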